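/- **Setting.** Fix $x_0<0$ and $0<\underline k<\overline k$; a prime denotes $\partial_x$. *Exact data.* Let $c^*\in C^2(\mathbb R)$, $c^*\ge 1$, $c^*=1$ outside $(0,1)$. For every $k>0$ let $u^*(\cdot,k)$ solve $u''+k^2c^*u=-\delta(x-x_0)$ on $\mathbb R$ with $u'+iku\to0$ as $x\to+\infty$ and $u'-iku\to0$ as $x\to-\infty$. Let $u_0(x,k)=e^{-ik|x-x_0|}/(2ik)$ be the solution for $c\equiv1$, and $w^*=u^*/u_0$. For $x\in[0,1]$ let $\log w^*(x,k)$ be the logarithm that is continuous in $k\in(0,\infty)$ and satisfies $\log w^*(x,k)=-\tfrac14\ln c^*(x)-ik\big(\int_{x_0}^x\sqrt{c^*(\xi)}\,d\xi-x+x_0\big)+o(1)$ as $k\to\infty$. Put $g_0^*(k)=w^*(0,k)$ and write the exact tail as $V^*(x)=\overline k^{-2}\log w^*(x,\overline k)=r^*(x)/\overline k$. *Noisy data.* Let $0<\delta<1$, and let $g_0\in C^1[\underline k,\overline k]$ be complex valued with a continuous logarithm $\log g_0$ such that on $[\underline k,\overline k]$ $$|\log g_0-\log g_0^*|\le\delta,\qquad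 |g_0-g_0^*|\le\delta,\qquad |g_0'-(g_0^*)'|\le\delta,$$ where here the prime is $d/dk$. Put $p_0(k)=\frac{d}{dk}\big(\frac{\log g_0(k)}{k^2}\big)$, $p_1(k)=\frac{d}{dk}\big[\frac{2i}{k}\big(1-\frac1{g_0(k)}\big)\big]$ and $m(x,k)=(x^2-1)^2p_0(k)+x(x^2-1)^2p_1(k)$. *Tail.* Let $V$ be a minimizer of $\frac12\big(\|V''\|^2_{L^2(0,1)}+\delta^2\|V\|^2_{H^3(0,1)}\big)$ over the complex valued $V\in H^3(0,1)$ with $V(0)=\frac{\log g_0(\overline k)}{\overline k^2}$, $V'(0)=\frac{2i}{\overline k}\big(1-\frac1{g_0(\overline k)}\big)$, $V'(1)=0$. *Functional.* Let $H$ be the real Hilbert space of the functions $f=(f_1,f_2)$, identified with $f_1+if_2$, on $(0,1)\times(\underline k,\overline k)$ with $f(\cdot,k)\in H^2(0,1)$ and $f(0,k)=f'(0,k)=f'(1,k)=0$ for almost every $k$, and $\|f\|_H^2=\int_{\underline k}^{\overline k}\|f(\cdot,k)\|^2_{H^2(0,1)}dk<\infty$. For $p\in H$ put $q=p+m$, $T(x,k)=-\int_k^{\overline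 k}q'(x,\tau)\,d\tau+V'(x)$, $$L(p)=q''-2ikq'+2k^2q'T-2iT+2kT^2,\qquad J_\lambda(p)=e^{2\lambda}\int_{\underline k}^{\overline k}\!\int_0^1|L(p)|^2e^{-2\lambda x}\,dx\,dk .$$ **Theorem.** For every $p\in H$, $L(p)$ is square integrable on $(0,1)\times(\underline k,\overline k)$, so that $J_\lambda(p)$ is finite, and for every real $\lambda$ the functional $J_\lambda$ is Fréchet differentiable at every $p\in H$. Moreover there is an absolute constant $C>0$ such that for every $R>0$ and $M$ there is $\lambda_0>1$ (with $x_0$ fixed) depending only on $r^*,\underline k,\overline k,M,R$, such that, whenever $\max_{[\underline k,\overline k]}|p_1|\le M$, for all $\lambda\ge\lambda_0$ and all $p,\,p+h$ in the closed ball $\overline{B(R)}=\{f\in H:\|f\|_H\le R\}$ $$J_\lambda(p+h)-J_\lambda(p)-J_\lambda'(p)(h)\ \ge\ C\|h\|_H^2 .$$ -/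

import Mathlib

open MeasureTheory Set Filter
open scoped Topology ENNReal ContDiff

namespace InverseMedium

noncomputable section

/-! ### Sobolev functions on the interval `(0, 1)` -/

/-- Lebesgue measure on the interval `(0, 1)`. -/
abbrev unitMeasure : Measure ℝ := volume.restrict (Ioo 0 1)

/-- `g` is the weak derivative of `f` on `(0, 1)`, tested against `C_c^∞(0, 1)`. -/
def IsWeakDeriv (f g : ℝ → ℂ) : Prop :=
  ∀ φ : ℝ → ℝ, ContDiff ℝ ∞ φ → HasCompactSupport φ → tsupport φ ⊆ Ioo 0 1 →
    ∫ x, ((deriv φ x : ℝ) : ℂ) * f x ∂unitMeasure = - ∫ x, ((φ x : ℝ) : ℂ) * g x ∂unitMeasure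

/-- `D 0` belongs to the complex Sobolev space `H^n(0, 1)` and `D j` is its `j`-th weak
derivative, for `j = 0, …, n`. -/
structure IsSobolev (n : ℕ) (D : Fin (n + 1) → ℝ → ℂ) : Prop where
  memLp : ∀ j, MemLp (D j) 2 unitMeasure
  weakDeriv : ∀ j : Fin n, IsWeakDeriv (D j.castSucc) (D j.succ)

/-- `‖D 0‖²` in `H^n(0, 1)`. -/
def sobolevNormSq (n : ℕ) (D : Fin (n + 1) → ℝ → ℂ) : ℝ :=
  ∑ j, ∫ x, ‖D j x‖ ^ 2 ∂unitMeasure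

/-- Boundary values `f(0) = a`, `f'(0) = b`, `f'(1) = b'`, read off from the representative of
`f` in `C^1[0, 1]`. (By the embedding `H^2(0, 1) ⊂ C^1[0, 1]` every Sobolev function considered
below has exactly one such representative.) -/
def HasBoundaryValues (f : ℝ → ℂ) (a b b' : ℂ) : Prop :=
  ∃ u : ℝ → ℂ, ContDiffOn ℝ 1 u (Icc 0 1) ∧ f =ᵐ[unitMeasure] u ∧
    u 0 = a ∧ derivWithin u (Icc 0 1) 0 = b ∧ derivWithin u (Icc 0 1) 1 = b'

theorem integrable_test_mul {φ : ℝ → ℝ} (hφ : Continuous φ) (hc : HasCompactSupport φ)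
    {f : ℝ → ℂ} (hf : MemLp f 2 unitMeasure) :
    Integrable (fun x => ((φ x : ℝ) : ℂ) * f x) unitMeasure := by
  have hf1 : Integrable f unitMeasure := hf.integrable (by norm_num)
  obtain ⟨B, hB⟩ := hc.exists_bound_of_continuous hφ
  refine hf1.bdd_mul (c := B) ?_ (Eventually.of_forall fun x => ?_)
  · exact (Complex.continuous_ofReal.comp hφ).aestronglyMeasurable
  · simpa using hB x

theorem IsWeakDeriv.add {f g f' g' : ℝ → ℂ} (h : IsWeakDeriv f f') (h' : IsWeakDeriv g g')
    (hf : MemLp f 2 unitMeasure) (hg : MemLp g 2 unitMeasure)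
    (hf' : MemLp f' 2 unitMeasure) (hg' : MemLp g' 2 unitMeasure) :
    IsWeakDeriv (f + g) (f' + g') := by
  intro φ h1 h2 h3
  have hd : Continuous (deriv φ) := h1.continuous_deriv (by simp)
  simp only [Pi.add_apply, mul_add]
  rw [integral_add (integrable_test_mul hd h2.deriv hf) (integrable_test_mul hd h2.deriv hg),
    integral_add (integrable_test_mul h1.continuous h2 hf')
      (integrable_test_mul h1.continuous h2 hg'), h φ h1 h2 h3, h' φ h1 h2 h3]
  ring

theorem IsWeakDeriv.smul {f f' : ℝ → ℂ} (h : IsWeakDeriv f f') (a : ℝ) :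
    IsWeakDeriv (a • f) (a • f') := by
  intro φ h1 h2 h3
  simp only [Pi.smul_apply, mul_smul_comm]
  rw [integral_smul, integral_smul, h φ h1 h2 h3, smul_neg]

theorem IsWeakDeriv.congr {f g f' g' : ℝ → ℂ} (h : IsWeakDeriv f f')
    (e : f =ᵐ[unitMeasure] g) (e' : f' =ᵐ[unitMeasure] g') : IsWeakDeriv g g' := by
  intro φ h1 h2 h3
  have a1 : ∫ x, ((deriv φ x : ℝ) : ℂ) * g x ∂unitMeasure
      = ∫ x, ((deriv φ x : ℝ) : ℂ) * f x ∂unitMeasure :=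
    integral_congr_ae (e.mono fun x hx => by simp only [hx])
  have a2 : ∫ x, ((φ x : ℝ) : ℂ) * g' x ∂unitMeasure
      = ∫ x, ((φ x : ℝ) : ℂ) * f' x ∂unitMeasure :=
    integral_congr_ae (e'.mono fun x hx => by simp only [hx])
  rw [a1, a2, h φ h1 h2 h3]

theorem IsSobolev.congr {n : ℕ} {D E : Fin (n + 1) → ℝ → ℂ} (h : IsSobolev n D)
    (e : ∀ j, D j =ᵐ[unitMeasure] E j) : IsSobolev n E :=
  ⟨fun j => (memLp_congr_ae (e j)).1 (h.memLp j),
    fun j => (h.weakDeriv j).congr (e _) (e _)⟩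

theorem IsSobolev.add {n : ℕ} {D E : Fin (n + 1) → ℝ → ℂ} (h : IsSobolev n D)
    (h' : IsSobolev n E) : IsSobolev n (D + E) :=
  ⟨fun j => (h.memLp j).add (h'.memLp j), fun j => (h.weakDeriv j).add (h'.weakDeriv j)
    (h.memLp _) (h'.memLp _) (h.memLp _) (h'.memLp _)⟩

theorem IsSobolev.smul {n : ℕ} {D : Fin (n + 1) → ℝ → ℂ} (h : IsSobolev n D) (a : ℝ) :
    IsSobolev n (a • D) :=
  ⟨fun j => (h.memLp j).const_smul a, fun j => (h.weakDeriv j).smul a⟩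

theorem isSobolev_zero (n : ℕ) : IsSobolev n (0 : Fin (n + 1) → ℝ → ℂ) :=
  ⟨fun _ => MemLp.zero, fun _ φ _ _ _ => by simp⟩

theorem HasBoundaryValues.congr {f g : ℝ → ℂ} {a b b' : ℂ} (h : HasBoundaryValues f a b b')
    (e : f =ᵐ[unitMeasure] g) : HasBoundaryValues g a b b' := by
  obtain ⟨u, h1, h2, h3⟩ := h
  exact ⟨u, h1, e.symm.trans h2, h3⟩

theorem HasBoundaryValues.add_zero {f g : ℝ → ℂ} (h : HasBoundaryValues f 0 0 0)
    (h' : HasBoundaryValues g 0 0 0) : HasBoundaryValues (f + g) 0 0 0 := by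
  obtain ⟨u, h1, h2, h3, h4, h5⟩ := h
  obtain ⟨v, g1, g2, g3, g4, g5⟩ := h'
  have du : ∀ x ∈ Icc (0 : ℝ) 1, DifferentiableWithinAt ℝ u (Icc 0 1) x :=
    h1.differentiableOn (by simp)
  have dv : ∀ x ∈ Icc (0 : ℝ) 1, DifferentiableWithinAt ℝ v (Icc 0 1) x :=
    g1.differentiableOn (by simp)
  refine ⟨u + v, h1.add g1, h2.add g2, by simp [h3, g3], ?_, ?_⟩
  · rw [derivWithin_add (du 0 (by simp)) (dv 0 (by simp)), h4, g4, zero_add]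
  · rw [derivWithin_add (du 1 (by simp)) (dv 1 (by simp)), h5, g5, zero_add]

theorem HasBoundaryValues.smul_zero {f : ℝ → ℂ} (h : HasBoundaryValues f 0 0 0) (a : ℝ) :
    HasBoundaryValues (a • f) 0 0 0 := by
  obtain ⟨u, h1, h2, h3, h4, h5⟩ := h
  have du : ∀ x ∈ Icc (0 : ℝ) 1, DifferentiableWithinAt ℝ u (Icc 0 1) x :=
    h1.differentiableOn (by simp)
  refine ⟨a • u, contDiffOn_const.smul h1, h2.const_smul a, by simp [h3], ?_, ?_⟩
  · rw [derivWithin_const_smul a (du 0 (by simp)), h4, _root_.smul_zero]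
  · rw [derivWithin_const_smul a (du 1 (by simp)), h5, _root_.smul_zero]

theorem hasBoundaryValues_zero : HasBoundaryValues (0 : ℝ → ℂ) 0 0 0 :=
  ⟨0, contDiffOn_const, EventuallyEq.rfl, rfl, by simp, by simp⟩

/-! ### The Hilbert space `H` -/

/-- Lebesgue measure on the rectangle `(0, 1) × (k₁, k₂)` of points `(x, k)`. -/
abbrev rectMeasure (k₁ k₂ : ℝ) : Measure (ℝ × ℝ) :=
  unitMeasure.prod (volume.restrict (Ioo k₁ k₂))

theorem ae_slice {k₁ k₂ : ℝ} {P : ℝ × ℝ → Prop} (h : ∀ᵐ z ∂rectMeasure k₁ k₂, P z) :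
    ∀ᵐ k ∂(volume.restrict (Ioo k₁ k₂)), ∀ᵐ x ∂unitMeasure, P (x, k) := by
  have h' : ∀ᵐ z ∂((volume.restrict (Ioo k₁ k₂)).prod unitMeasure), P z.swap := by
    rw [rectMeasure, ← Measure.prod_swap] at h
    exact ae_of_ae_map measurable_swap.aemeasurable h
  exact Measure.ae_ae_of_ae_prod h'

/-- The space `H`. Its elements are the functions `f(x, k)` on `(0, 1) × (k₁, k₂)` with
`f(·, k) ∈ H^2(0, 1)` and `f(0, k) = f'(0, k) = f'(1, k) = 0` for almost every `k`, and with
`‖f‖² = ∫ ‖f(·, k)‖²_{H^2(0, 1)} dk < ∞`; such an `f` is recorded as the triple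
`(f, f', f'')` of classes in `L^2` of the rectangle (the prime is the weak derivative in `x`),
which carries exactly this norm. A pair `(f₁, f₂)` of real functions is the function
`f₁ + i f₂`, so that the scalars are real and `|f|² = f₁² + f₂²`. -/
def spaceH (k₁ k₂ : ℝ) : Submodule ℝ (PiLp 2 fun _ : Fin 3 => Lp ℂ 2 (rectMeasure k₁ k₂)) where
  carrier := {F | ∀ᵐ k ∂(volume.restrict (Ioo k₁ k₂)),
    IsSobolev 2 (fun j x => F j (x, k)) ∧ HasBoundaryValues (fun x => F 0 (x, k)) 0 0 0}
  add_mem' := by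
    intro F G hF hG
    have e : ∀ᵐ z ∂rectMeasure k₁ k₂, ∀ j, F j z + G j z = (F + G) j z :=
      ae_all_iff.2 fun j => (Lp.coeFn_add (F j) (G j)).mono fun z hz => hz.symm
    filter_upwards [hF, hG, ae_slice e] with k hFk hGk hk
    exact ⟨(hFk.1.add hGk.1).congr fun j => hk.mono fun x hx => hx j,
      (hFk.2.add_zero hGk.2).congr (hk.mono fun x hx => hx 0)⟩
  zero_mem' := by
    have e : ∀ᵐ z ∂rectMeasure k₁ k₂, ∀ j : Fin 3, (0 : ℂ) =
        (0 : PiLp 2 fun _ : Fin 3 => Lp ℂ 2 (rectMeasure k₁ k₂)) j z :=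
      ae_all_iff.2 fun j => (Lp.coeFn_zero ℂ 2 (rectMeasure k₁ k₂)).mono fun z hz => hz.symm
    filter_upwards [ae_slice e] with k hk
    exact ⟨(isSobolev_zero 2).congr fun j => hk.mono fun x hx => hx j,
      hasBoundaryValues_zero.congr (hk.mono fun x hx => hx 0)⟩
  smul_mem' := by
    intro a F hF
    have e : ∀ᵐ z ∂rectMeasure k₁ k₂, ∀ j, a • F j z = (a • F) j z :=
      ae_all_iff.2 fun j => (Lp.coeFn_smul a (F j)).mono fun z hz => hz.symm
    filter_upwards [hF, ae_slice e] with k hFk hk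
    exact ⟨(hFk.1.smul a).congr fun j => hk.mono fun x hx => hx j,
      (hFk.2.smul_zero a).congr (hk.mono fun x hx => hx 0)⟩

/-! ### The forward problem and the exact data -/

/-- The coefficient: `c ∈ C^2(ℝ)`, `c ≥ 1`, and `c = 1` outside `(0, 1)`. -/
structure IsCoefficient (c : ℝ → ℝ) : Prop where
  contDiff : ContDiff ℝ 2 c
  one_le : ∀ x, 1 ≤ c x
  eq_one : ∀ x, x ∉ Ioo (0 : ℝ) 1 → c x = 1

/-- `u` solves `u'' + k² c u = -δ(x - x₀)` on `ℝ` with the radiation conditions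
`u' + i k u → 0` at `+∞` and `u' - i k u → 0` at `-∞`. The point source means: `u` is
continuous, satisfies the homogeneous equation off `x₀`, and `u'` jumps by `-1` at `x₀`. -/
structure IsForwardSolution (x₀ k : ℝ) (c : ℝ → ℝ) (u : ℝ → ℂ) : Prop where
  continuous : Continuous u
  differentiableAt : ∀ x, x ≠ x₀ → DifferentiableAt ℝ u x
  equation : ∀ x, x ≠ x₀ → HasDerivAt (deriv u) (-((k : ℂ) ^ 2 * (c x : ℂ) * u x)) x
  jump : ∃ a b : ℂ, Tendsto (deriv u) (𝓝[<] x₀) (𝓝 a) ∧ Tendsto (deriv u) (𝓝[>] x₀) (𝓝 b) ∧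
    b - a = -1
  radiation_top : Tendsto (fun x => deriv u x + Complex.I * k * u x) atTop (𝓝 0)
  radiation_bot : Tendsto (fun x => deriv u x - Complex.I * k * u x) atBot (𝓝 0)

/-- The solution `u₀` of the forward problem for `c = 1`. -/
def incident (x₀ x k : ℝ) : ℂ :=
  Complex.exp (-(Complex.I * k * |x - x₀|)) / (2 * Complex.I * k)

/-- The ratio `w = u / u₀`. -/
def ratio (x₀ : ℝ) (u : ℝ → ℝ → ℂ) (x k : ℝ) : ℂ := u x k / incident x₀ x k

/-- `ψ` is the logarithm of `w` on `[0, 1] × (0, ∞)`: the branch that is continuous in `k` and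
satisfies `ψ = -(1/4) ln c - i k (∫_{x₀}^x √c dξ - x + x₀) + o(1)` as `k → ∞`. -/
structure IsLogBranch (x₀ : ℝ) (c : ℝ → ℝ) (w ψ : ℝ → ℝ → ℂ) : Prop where
  continuousOn : ∀ x ∈ Icc (0 : ℝ) 1, ContinuousOn (ψ x) (Ioi 0)
  exp_eq : ∀ x ∈ Icc (0 : ℝ) 1, ∀ k, 0 < k → Complex.exp (ψ x k) = w x k
  asymptotics : ∀ x ∈ Icc (0 : ℝ) 1,
    Tendsto (fun k : ℝ => ψ x k - (-((Real.log (c x) / 4 : ℝ) : ℂ)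
      - Complex.I * k * (((∫ ξ in x₀..x, √(c ξ)) - x + x₀ : ℝ) : ℂ))) atTop (𝓝 0)

/-! ### The noisy data and the tail -/

/-- `g ∈ C^1[k₁, k₂]` is noisy data with logarithm `ℓ`, and `g`, `ℓ`, `g'` are within `δ` of
the exact data `gs`, of its logarithm `ℓs` and of `gs'` on `[k₁, k₂]`. -/
structure IsNoisyData (k₁ k₂ δ : ℝ) (gs ℓs g ℓ : ℝ → ℂ) : Prop where
  contDiffOn : ContDiffOn ℝ 1 g (Icc k₁ k₂)
  continuousOn_log : ContinuousOn ℓ (Icc k₁ k₂)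
  exp_log : ∀ k ∈ Icc k₁ k₂, Complex.exp (ℓ k) = g k
  log_close : ∀ k ∈ Icc k₁ k₂, ‖ℓ k - ℓs k‖ ≤ δ
  close : ∀ k ∈ Icc k₁ k₂, ‖g k - gs k‖ ≤ δ
  deriv_close : ∀ k ∈ Icc k₁ k₂,
    ‖derivWithin g (Icc k₁ k₂) k - derivWithin gs (Icc k₁ k₂) k‖ ≤ δ

/-- `D 0` lies in the set `W`: it belongs to `H^3(0, 1)`, with weak derivatives `D 1, D 2, D 3`,
and satisfies `V(0) = ℓ(k₂) / k₂²`, `V'(0) = (2i / k₂)(1 - 1 / g(k₂))`, `V'(1) = 0`. -/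
def MemW (k₂ : ℝ) (g ℓ : ℝ → ℂ) (D : Fin 4 → ℝ → ℂ) : Prop :=
  IsSobolev 3 D ∧ HasBoundaryValues (D 0) (ℓ k₂ / (k₂ : ℂ) ^ 2)
    (2 * Complex.I / k₂ * (1 - 1 / g k₂)) 0

/-- The quasi-reversibility functional `(‖V''‖²_{L^2} + α ‖V‖²_{H^3}) / 2`. -/
def tailFunctional (α : ℝ) (D : Fin 4 → ℝ → ℂ) : ℝ :=
  (1 / 2) * ((∫ x, ‖D 2 x‖ ^ 2 ∂unitMeasure) + α * sobolevNormSq 3 D)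

/-- `D 0` minimizes the quasi-reversibility functional on `W`. -/
def IsTail (k₂ α : ℝ) (g ℓ : ℝ → ℂ) (D : Fin 4 → ℝ → ℂ) : Prop :=
  MemW k₂ g ℓ D ∧ ∀ E, MemW k₂ g ℓ E → tailFunctional α D ≤ tailFunctional α E

/-! ### The weighted cost functional -/

/-- `p₀(k) = d/dk (log g(k) / k²)`. -/
def bdry₀ (k₁ k₂ : ℝ) (ℓ : ℝ → ℂ) (k : ℝ) : ℂ :=
  derivWithin (fun s : ℝ => ℓ s / (s : ℂ) ^ 2) (Icc k₁ k₂) k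

/-- `p₁(k) = d/dk [(2i / k)(1 - 1 / g(k))]`. -/
def bdry₁ (k₁ k₂ : ℝ) (g : ℝ → ℂ) (k : ℝ) : ℂ :=
  derivWithin (fun s : ℝ => 2 * Complex.I / s * (1 - 1 / g s)) (Icc k₁ k₂) k

/-- `m(x, k) = (x² - 1)² p₀(k) + x (x² - 1)² p₁(k)`. -/
def lift (p₀ p₁ : ℝ → ℂ) (x k : ℝ) : ℂ :=
  ((x : ℂ) ^ 2 - 1) ^ 2 * p₀ k + x * ((x : ℂ) ^ 2 - 1) ^ 2 * p₁ k

/-- The first `x`-derivative `p' + m'`. -/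
def first (p₀ p₁ : ℝ → ℂ) {k₁ k₂ : ℝ} (p : spaceH k₁ k₂) (x k : ℝ) : ℂ :=
  p.1 1 (x, k) + deriv (fun y => lift p₀ p₁ y k) x

/-- The second `x`-derivative `p'' + m''`. -/
def second (p₀ p₁ : ℝ → ℂ) {k₁ k₂ : ℝ} (p : spaceH k₁ k₂) (x k : ℝ) : ℂ :=
  p.1 2 (x, k) + iteratedDeriv 2 (fun y => lift p₀ p₁ y k) x

/-- `-∫_k^{k₂} (p' + m')(x, τ) dτ + V'(x)`. -/
def inner₁ (p₀ p₁ V' : ℝ → ℂ) {k₁ k₂ : ℝ} (p : spaceH k₁ k₂) (x k : ℝ) : ℂ :=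
  -(∫ τ in k..k₂, first p₀ p₁ p x τ) + V' x

/-- The nonlinear integro-differential operator `L(p)(x, k)`. -/
def opL (p₀ p₁ V' : ℝ → ℂ) {k₁ k₂ : ℝ} (p : spaceH k₁ k₂) (z : ℝ × ℝ) : ℂ :=
  second p₀ p₁ p z.1 z.2 - 2 * Complex.I * z.2 * first p₀ p₁ p z.1 z.2
    + 2 * (z.2 : ℂ) ^ 2 * first p₀ p₁ p z.1 z.2 * inner₁ p₀ p₁ V' p z.1 z.2
    - 2 * Complex.I * inner₁ p₀ p₁ V' p z.1 z.2
    + 2 * (z.2 : ℂ) * inner₁ p₀ p₁ V' p z.1 z.2 ^ 2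

/-- `J_lam(p) = e^{2 lam} ∫∫ |L(p)|² e^{-2 lam x} dx dk`. -/
def costJ (p₀ p₁ V' : ℝ → ℂ) {k₁ k₂ : ℝ} (lam : ℝ) (p : spaceH k₁ k₂) : ℝ :=
  Real.exp (2 * lam) *
    ∫ z, ‖opL p₀ p₁ V' p z‖ ^ 2 * Real.exp (-2 * lam * z.1) ∂rectMeasure k₁ k₂

end

end InverseMedium

/-!
The increment of `L` in a direction `h` is `h''` plus terms that contain `h'` or
`S(x, k) = -∫_k^{k₂} h'(x, τ) dτ` as a factor, and the remainder of `J_λ` beyond first order is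
`e^{2λ} ∫∫ (|A + N|² + 2 Re (conj L(p) N)) e^{-2λx}`, where `A` and `N` are the linear and the
quadratic part of this increment (`IsBoundedData.costJ_add`). Hence it is at least
`e^{2λ} ∫∫ (|h''|² / 2 - ρ) e^{-2λx}`, with lower order terms `ρ` that are quadratic in `(h', S)`
(`quadOpRem_bounds`).

Since `h'(0, k) = 0`, `h'` is the indefinite integral of `h''`, and Cauchy-Schwarz gives the
Carleman estimate `|h'(x, k)|² e^{-2λx} ≤ (2λ)⁻¹ ∫ |h''(y, k)|² e^{-2λy} dy`. It bounds the squares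
of the weighted `L²` norm of `h'` and of the weighted sup norm of `S` by `(2λ)⁻¹ Q` times a
constant, where `Q = ∫∫ |h''|² e^{-2λx}`. The sup bound for `S` matters: the coefficients of `ρ` contain `q'` and
`L(p)`, which are only square integrable, and every such coefficient comes with a factor `S`. So
`ρ` is absorbed for large `λ`, what remains is at least `e^{2λ} Q / 4 ≥ ‖h''‖² / 4`, and
`‖h‖² ≤ 3 ‖h''‖²` gives the constant `1 / 12`. The same bounds with a crude constant in place of
`(2λ)⁻¹` show that the remainder is `O(‖h‖²)`, which is Fréchet differentiability.

The threshold for `λ` depends only on `k₁`, `k₂`, `R` and sup bounds for `p₀`, `p₁` and `V'`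
(`exists_strictConvexity`), and these are uniform in the data. Conservation of flux
bounds the exact ratio at `x = 0` by `2` for every coefficient and frequency
(`IsForwardSolution.norm_zero_le`). The exact tail fixes the exact logarithm at the frequency
`k₂`; integrating `p₁` from there bounds `(2i/k)(1 - 1/g₀)`, then `g₀'/g₀`, and so `p₀`
(`exists_data_bounds`). Comparing `V` with a quadratic polynomial bounds `‖V''‖` in `L²`, hence `V'`, as
`V'(0)` is known (`IsTail.norm_deriv_le`).
-/

namespace InverseMedium

noncomputable section

/-! ### Weak derivatives on the unit interval -/

/-- Integration by parts of a test function against an indefinite integral, by Fubini on the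
triangle `y < x`. -/
theorem integral_deriv_mul_primitive {g : ℝ → ℂ} (hg : Integrable g unitMeasure) {φ : ℝ → ℝ}
    (h1 : ContDiff ℝ ∞ φ) (h2 : HasCompactSupport φ) (h3 : tsupport φ ⊆ Ioo 0 1) :
    ∫ x, ((deriv φ x : ℝ) : ℂ) * (∫ y in (0 : ℝ)..x, g y) ∂unitMeasure
      = - ∫ x, ((φ x : ℝ) : ℂ) * g x ∂unitMeasure := by
  have hd : Continuous (deriv φ) := h1.continuous_deriv (by simp)
  have hφ1 : φ 1 = 0 := by
    by_contra h
    have := h3 (subset_tsupport φ h)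
    simp at this
  have hdi : Integrable (fun x => ((deriv φ x : ℝ) : ℂ)) unitMeasure := by
    refine Integrable.ofReal ?_
    exact (hd.integrable_of_hasCompactSupport h2.deriv).restrict
  have hI : Integrable (Function.uncurry fun x y : ℝ =>
      {z : ℝ × ℝ | z.2 < z.1}.indicator (fun z => ((deriv φ z.1 : ℝ) : ℂ) * g z.2) (x, y))
      (unitMeasure.prod unitMeasure) := by
    refine Integrable.indicator (hdi.mul_prod hg) ?_
    exact measurableSet_lt measurable_snd measurable_fst
  have hswap := integral_integral_swap hI
  have hL : ∫ x, ((deriv φ x : ℝ) : ℂ) * (∫ y in (0 : ℝ)..x, g y) ∂unitMeasure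
      = ∫ x, ∫ y, {z : ℝ × ℝ | z.2 < z.1}.indicator
        (fun z => ((deriv φ z.1 : ℝ) : ℂ) * g z.2) (x, y) ∂unitMeasure ∂unitMeasure := by
    refine setIntegral_congr_fun measurableSet_Ioo fun x hx => ?_
    have e : (fun y => {z : ℝ × ℝ | z.2 < z.1}.indicator
        (fun z => ((deriv φ z.1 : ℝ) : ℂ) * g z.2) (x, y))
        = (Iio x).indicator fun y => ((deriv φ x : ℝ) : ℂ) * g y := by
      funext y
      by_cases h : y < x <;> simp [indicator, h]
    simp only [e]
    rw [integral_indicator measurableSet_Iio, integral_const_mul,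
      intervalIntegral.integral_of_le hx.1.le, Measure.restrict_restrict measurableSet_Iio,
      integral_Ioc_eq_integral_Ioo]
    congr 3
    ext y
    simp only [mem_inter_iff, mem_Iio, mem_Ioo]
    exact ⟨fun h => ⟨h.2, h.1, h.2.trans hx.2⟩, fun h => ⟨h.2.1, h.1⟩⟩
  rw [hL, hswap, ← integral_neg]
  refine setIntegral_congr_fun measurableSet_Ioo fun y hy => ?_
  have e : (fun x => {z : ℝ × ℝ | z.2 < z.1}.indicator
      (fun z => ((deriv φ z.1 : ℝ) : ℂ) * g z.2) (x, y))
      = (Ioi y).indicator fun x => ((deriv φ x : ℝ) : ℂ) * g y := by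
    funext x
    by_cases h : y < x <;> simp [indicator, h]
  simp only [e]
  rw [integral_indicator measurableSet_Ioi, integral_mul_const,
    Measure.restrict_restrict measurableSet_Ioi]
  have hs : Ioi y ∩ Ioo 0 1 = Ioo y 1 := by
    ext x
    simp only [mem_inter_iff, mem_Ioi, mem_Ioo]
    exact ⟨fun h => ⟨h.1, h.2.2⟩, fun h => ⟨h.1, hy.1.trans h.1, h.2⟩⟩
  have hv : ∫ x in Ioo y 1, ((deriv φ x : ℝ) : ℂ) = ((- φ y : ℝ) : ℂ) := by
    rw [integral_complex_ofReal, ← integral_Ioc_eq_integral_Ioo,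
      ← intervalIntegral.integral_of_le hy.2.le,
      intervalIntegral.integral_deriv_eq_sub (fun x _ => (h1.differentiable (by simp)) x)
        (hd.intervalIntegrable _ _), hφ1, zero_sub]
  rw [hs, hv]
  push_cast
  ring

/-- Du Bois-Reymond: a function with vanishing weak derivative is constant. A test function
of integral zero is the derivative of a test function. -/
theorem IsWeakDeriv.ae_eq_const {f : ℝ → ℂ} (hf : Integrable f unitMeasure)
    (h : IsWeakDeriv f 0) : ∃ c : ℂ, f =ᵐ[unitMeasure] fun _ => c := by
  let b : ContDiffBump (1 / 2 : ℝ) := ⟨1 / 8, 1 / 4, by norm_num, by norm_num⟩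
  let ψ : ℝ → ℝ := b.normed volume
  have ψ1 : ContDiff ℝ ∞ ψ := b.contDiff_normed
  have ψ2 : HasCompactSupport ψ := b.hasCompactSupport_normed
  have ψ3 : tsupport ψ ⊆ Ioo 0 1 := by
    rw [b.tsupport_normed_eq, Real.closedBall_eq_Icc]
    intro x hx
    simp only [mem_Icc, mem_Ioo, b] at hx ⊢
    constructor <;> linarith [hx.1, hx.2]
  have ψ4 : ∫ x, ψ x = 1 := b.integral_normed
  refine ⟨∫ x, ((ψ x : ℝ) : ℂ) * f x ∂unitMeasure, ?_⟩
  set c := ∫ x, ((ψ x : ℝ) : ℂ) * f x ∂unitMeasure with hc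
  have mulInt : ∀ χ : ℝ → ℝ, Continuous χ → HasCompactSupport χ →
      Integrable (fun x => ((χ x : ℝ) : ℂ) * f x) unitMeasure := by
    intro χ h1 h2
    obtain ⟨B, hB⟩ := h2.exists_bound_of_continuous h1
    refine hf.bdd_mul (c := B) ?_ (Eventually.of_forall fun x => ?_)
    · exact (Complex.continuous_ofReal.comp h1).aestronglyMeasurable
    · simpa using hB x
  have key : ∀ χ : ℝ → ℝ, ContDiff ℝ ∞ χ → HasCompactSupport χ → tsupport χ ⊆ Ioo 0 1 →
      ∫ x, χ x • (f x - c) ∂unitMeasure = 0 := by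
    intro χ h1 h2 h3
    -- `χ - (∫ χ) ψ` has integral zero, so its indefinite integral `φ` is a test function.
    set I := ∫ x, χ x with hI
    set η : ℝ → ℝ := fun x => χ x - I * ψ x with hη
    have η1 : ContDiff ℝ ∞ η := h1.sub (contDiff_const.mul ψ1)
    have hK : IsCompact (tsupport χ ∪ tsupport ψ) := h2.isCompact.union ψ2.isCompact
    have hKne : (tsupport χ ∪ tsupport ψ).Nonempty := by
      refine Nonempty.inr ?_
      by_contra hne
      rw [not_nonempty_iff_eq_empty, tsupport_eq_empty_iff] at hne
      rw [hne] at ψ4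
      simp at ψ4
    have hKs : tsupport χ ∪ tsupport ψ ⊆ Ioo 0 1 := union_subset h3 ψ3
    obtain ⟨α, hα, hαm⟩ := hK.exists_isLeast hKne
    obtain ⟨β, hβ, hβm⟩ := hK.exists_isGreatest hKne
    have hα0 := hKs hα
    have hβ0 := hKs hβ
    have ηz : ∀ x, x ∉ Icc α β → η x = 0 := by
      intro x hx
      have hx' : x ∉ tsupport χ ∪ tsupport ψ := fun hm => hx ⟨hαm hm, hβm hm⟩
      simp only [mem_union, not_or] at hx'
      simp only [hη, image_eq_zero_of_notMem_tsupport hx'.1,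
        image_eq_zero_of_notMem_tsupport hx'.2, mul_zero, sub_zero]
    have ηI : Integrable η := (h1.continuous.integrable_of_hasCompactSupport h2).sub
      ((ψ1.continuous.integrable_of_hasCompactSupport ψ2).const_mul I)
    have η0 : ∫ x, η x = 0 := by
      simp only [hη]
      rw [integral_sub (h1.continuous.integrable_of_hasCompactSupport h2)
        ((ψ1.continuous.integrable_of_hasCompactSupport ψ2).const_mul I), integral_const_mul, ψ4]
      simp [hI]
    set φ : ℝ → ℝ := fun x => ∫ y in (0 : ℝ)..x, η y with hφ
    have φd : ∀ x, HasDerivAt φ (η x) x := fun x =>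
      intervalIntegral.integral_hasDerivAt_right (η1.continuous.intervalIntegrable _ _)
        (η1.continuous.stronglyMeasurableAtFilter _ _) η1.continuous.continuousAt
    have φd' : deriv φ = η := funext fun x => (φd x).deriv
    have φ1 : ContDiff ℝ ∞ φ := by
      rw [contDiff_infty_iff_deriv, φd']
      exact ⟨fun x => (φd x).differentiableAt, η1⟩
    have φs : Function.support φ ⊆ Icc α β := by
      intro x hx
      by_contra hn
      apply hx
      rw [mem_Icc, not_and_or, not_le, not_le] at hn
      rcases hn with hn | hn
      · refine (intervalIntegral.integral_congr fun y hy => ?_).trans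
          intervalIntegral.integral_zero
        refine ηz y fun hm => ?_
        have h4 : y ≤ max 0 x := hy.2
        rcases le_max_iff.1 h4 with h5 | h5
        · linarith [hm.1, hα0.1]
        · linarith [hm.1]
      · have h5 : ∫ y, η y = ∫ y in Ioc 0 x, η y := by
          refine (setIntegral_eq_integral_of_forall_compl_eq_zero fun y hy => ?_).symm
          refine ηz y fun hm => hy ⟨?_, ?_⟩
          · linarith [hm.1, hα0.1]
          · linarith [hm.2]
        simp only [hφ]
        rw [intervalIntegral.integral_of_le (by linarith [hβ0.1]), ← h5, η0]
    have φt : tsupport φ ⊆ Icc α β := closure_minimal φs isClosed_Icc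
    have φ2 : HasCompactSupport φ := isCompact_Icc.of_isClosed_subset isClosed_closure φt
    have := h φ φ1 φ2 (φt.trans fun x hx => ⟨by linarith [hx.1, hα0.1], by linarith [hx.2, hβ0.2]⟩)
    rw [φd'] at this
    simp only [Pi.zero_apply, mul_zero, integral_zero, neg_zero, hη] at this
    have e1 : ∀ x, ((χ x - I * ψ x : ℝ) : ℂ) * f x
        = ((χ x : ℝ) : ℂ) * f x - (I : ℂ) * (((ψ x : ℝ) : ℂ) * f x) := by
      intro x; push_cast; ring
    simp only [e1] at this
    rw [integral_sub (mulInt χ h1.continuous h2) ((mulInt ψ ψ1.continuous ψ2).const_mul _),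
      integral_const_mul, ← hc] at this
    have hχ : ∫ x, ((χ x : ℝ) : ℂ) * c ∂unitMeasure = I * c := by
      rw [integral_mul_const, integral_complex_ofReal]
      congr 2
      refine setIntegral_eq_integral_of_forall_compl_eq_zero fun y hy => ?_
      exact image_eq_zero_of_notMem_tsupport fun hm => hy (h3 hm)
    have e2 : ∀ x, χ x • (f x - c) = ((χ x : ℝ) : ℂ) * f x - ((χ x : ℝ) : ℂ) * c := by
      intro x
      rw [Complex.real_smul]
      ring
    simp only [e2]
    rw [integral_sub (mulInt χ h1.continuous h2), hχ, this]
    exact (Integrable.ofReal (h1.continuous.integrable_of_hasCompactSupport h2).restrict).mul_const _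
  have hloc : LocallyIntegrableOn (fun x => f x - c) (Ioo 0 1) unitMeasure :=
    (hf.sub (integrable_const c)).locallyIntegrable.locallyIntegrableOn _
  have := isOpen_Ioo.ae_eq_zero_of_integral_contDiff_smul_eq_zero hloc key
  filter_upwards [this, ae_restrict_mem measurableSet_Ioo] with x hx hm
  exact sub_eq_zero.1 (hx hm)

theorem continuousOn_primitive_unit {g : ℝ → ℂ} (hg : MemLp g 2 unitMeasure) :
    ContinuousOn (fun x => ∫ y in (0 : ℝ)..x, g y) (Icc 0 1) := by
  refine (intervalIntegral.continuousOn_primitive_interval (μ := volume) (b := 1) ?_).mono ?_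
  · rw [uIcc_of_le zero_le_one, integrableOn_Icc_iff_integrableOn_Ioo]
    exact hg.integrable (by norm_num)
  · rw [uIcc_of_le zero_le_one]

/-- A function with weak derivative `g` is, up to a constant, the indefinite integral of `g`. -/
theorem IsWeakDeriv.ae_eq_primitive {f g : ℝ → ℂ} (h : IsWeakDeriv f g)
    (hf : MemLp f 2 unitMeasure) (hg : MemLp g 2 unitMeasure) :
    ∃ c : ℂ, f =ᵐ[unitMeasure] fun x => c + ∫ y in (0 : ℝ)..x, g y := by
  have hgi : Integrable g unitMeasure := hg.integrable (by norm_num)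
  have hGc := continuousOn_primitive_unit hg
  have hG : MemLp (fun x => ∫ y in (0 : ℝ)..x, g y) 2 unitMeasure := by
    obtain ⟨B, hB⟩ := isCompact_Icc.exists_bound_of_continuousOn hGc
    refine MemLp.of_bound ((hGc.mono Ioo_subset_Icc_self).aestronglyMeasurable measurableSet_Ioo) B ?_
    filter_upwards [ae_restrict_mem measurableSet_Ioo] with x hx
    exact hB x (Ioo_subset_Icc_self hx)
  obtain ⟨c, hc⟩ := IsWeakDeriv.ae_eq_const (f := fun x => f x - ∫ y in (0 : ℝ)..x, g y)
    ((hf.sub hG).integrable (by norm_num)) (by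
      intro φ h1 h2 h3
      have hd : Continuous (deriv φ) := h1.continuous_deriv (by simp)
      simp only [mul_sub]
      rw [integral_sub (integrable_test_mul hd h2.deriv hf) (integrable_test_mul hd h2.deriv hG),
        integral_deriv_mul_primitive hgi h1 h2 h3, h φ h1 h2 h3]
      simp)
  exact ⟨c, hc.mono fun x hx => by simpa [sub_eq_iff_eq_add] using hx⟩

/-- The fundamental theorem of calculus in `H^2(0, 1)`, with the boundary values of the `C^1`
representative as constants of integration. -/
theorem HasBoundaryValues.ae_eq_primitive {D₀ D₁ D₂ : ℝ → ℂ} {a b b' : ℂ}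
    (hb : HasBoundaryValues D₀ a b b') (h₀ : MemLp D₀ 2 unitMeasure)
    (h₁ : MemLp D₁ 2 unitMeasure) (h₂ : MemLp D₂ 2 unitMeasure)
    (w₀ : IsWeakDeriv D₀ D₁) (w₁ : IsWeakDeriv D₁ D₂) :
    (D₀ =ᵐ[unitMeasure] fun x => a + ∫ y in (0 : ℝ)..x, D₁ y) ∧
      D₁ =ᵐ[unitMeasure] fun x => b + ∫ y in (0 : ℝ)..x, D₂ y := by
  obtain ⟨c₀, e₀⟩ := w₀.ae_eq_primitive h₀ h₁
  obtain ⟨c₁, e₁⟩ := w₁.ae_eq_primitive h₁ h₂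
  obtain ⟨u, hu, hue, hu0, hu0', -⟩ := hb
  have hU : ∀ x ∈ Icc (0 : ℝ) 1, u x = c₀ + ∫ y in (0 : ℝ)..x, D₁ y := by
    have hae : u =ᵐ[volume.restrict (Icc 0 1)] fun x => c₀ + ∫ y in (0 : ℝ)..x, D₁ y := by
      rw [← restrict_Ioo_eq_restrict_Icc]
      exact hue.symm.trans e₀
    exact Measure.eqOn_Icc_of_ae_eq volume zero_ne_one hae hu.continuousOn
      (continuousOn_const.add (continuousOn_primitive_unit h₁))
  have ha : c₀ = a := by
    have := hU 0 (by simp)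
    rw [hu0] at this
    simpa using this.symm
  have hint : ∀ x ∈ Icc (0 : ℝ) 1, u x
      = a + ∫ y in (0 : ℝ)..x, (c₁ + ∫ s in (0 : ℝ)..y, D₂ s) := by
    intro x hx
    rw [hU x hx, ha]
    congr 1
    refine intervalIntegral.integral_congr_ae_restrict ?_
    rw [uIoc_of_le hx.1, ← restrict_Ioo_eq_restrict_Ioc]
    exact ae_restrict_of_ae_restrict_of_subset (Ioo_subset_Ioo_right hx.2) e₁
  have hcc : ContinuousOn (fun y => c₁ + ∫ s in (0 : ℝ)..y, D₂ s) (Icc 0 1) :=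
    continuousOn_const.add (continuousOn_primitive_unit h₂)
  have hder : HasDerivWithinAt u (c₁ + ∫ s in (0 : ℝ)..0, D₂ s) (Icc 0 1) 0 := by
    have h1 : HasDerivWithinAt (fun x => ∫ y in (0 : ℝ)..x, (c₁ + ∫ s in (0 : ℝ)..y, D₂ s))
        (c₁ + ∫ s in (0 : ℝ)..0, D₂ s) (Icc 0 1) 0 := by
      have : Fact ((0 : ℝ) ∈ Icc (0 : ℝ) 1) := ⟨by simp⟩
      refine intervalIntegral.integral_hasDerivWithinAt_right (by simp) ?_ (hcc 0 (by simp))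
      exact ⟨Icc 0 1, self_mem_nhdsWithin, hcc.aestronglyMeasurable measurableSet_Icc⟩
    exact (h1.const_add a).congr hint (hint 0 (by simp))
  have hb' : c₁ = b := by
    have := hder.derivWithin (uniqueDiffOn_Icc zero_lt_one 0 (by simp))
    rw [hu0'] at this
    simpa using this.symm
  exact ⟨ha ▸ e₀, hb' ▸ e₁⟩

/-! ### The indefinite integral in the frequency variable -/

/-- The indefinite integral `∫_k^{k₂} f(x, τ) dτ` at the point `(x, k)`. -/
def tailIntegral (k₂ : ℝ) (f : ℝ × ℝ → ℂ) (z : ℝ × ℝ) : ℂ := ∫ τ in z.2..k₂, f (z.1, τ)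

theorem integral_mul_sq_le {α : Type*} [MeasurableSpace α] {μ : Measure α} {f g : α → ℝ}
    (hf : MemLp f 2 μ) (hg : MemLp g 2 μ) :
    (∫ a, f a * g a ∂μ) ^ 2 ≤ (∫ a, f a ^ 2 ∂μ) * ∫ a, g a ^ 2 ∂μ := by
  have hf2 : Integrable (fun a => f a ^ 2) μ := hf.integrable_sq
  have hg2 : Integrable (fun a => g a ^ 2) μ := hg.integrable_sq
  have hfg : Integrable (fun a => f a * g a) μ := hf.integrable_mul hg
  have key : ∀ t : ℝ, 0 ≤ (∫ a, f a ^ 2 ∂μ) * (t * t) + (2 * ∫ a, f a * g a ∂μ) * t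
      + ∫ a, g a ^ 2 ∂μ := by
    intro t
    have h : ∫ a, (f a * t + g a) ^ 2 ∂μ = (∫ a, f a ^ 2 ∂μ) * (t * t)
        + (2 * ∫ a, f a * g a ∂μ) * t + ∫ a, g a ^ 2 ∂μ := by
      have e : ∀ a, (f a * t + g a) ^ 2 = (f a ^ 2 * (t * t) + (f a * g a) * (2 * t)) + g a ^ 2 :=
        fun a => by ring
      simp only [e]
      have h1 : Integrable (fun a => f a ^ 2 * (t * t) + (f a * g a) * (2 * t)) μ :=
        (hf2.mul_const _).add (hfg.mul_const _)
      rw [integral_add h1 hg2, integral_add (hf2.mul_const _) (hfg.mul_const _),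
        integral_mul_const, integral_mul_const]
      ring
    rw [← h]
    exact integral_nonneg fun a => sq_nonneg _
  have := discrim_le_zero key
  unfold discrim at this
  nlinarith

section rect

variable {k₁ k₂ : ℝ}

theorem ae_rect_mem : ∀ᵐ z ∂rectMeasure k₁ k₂, z.1 ∈ Ioo (0 : ℝ) 1 ∧ z.2 ∈ Ioo k₁ k₂ := by
  have h1 : ∀ᵐ z ∂rectMeasure k₁ k₂, z.1 ∈ Ioo (0 : ℝ) 1 :=
    Measure.quasiMeasurePreserving_fst.ae (ae_restrict_mem measurableSet_Ioo)
  have h2 : ∀ᵐ z ∂rectMeasure k₁ k₂, z.2 ∈ Ioo k₁ k₂ :=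
    Measure.quasiMeasurePreserving_snd.ae (ae_restrict_mem measurableSet_Ioo)
  exact h1.and h2

theorem ae_rect_of_ae_ae {P : ℝ → ℝ → Prop} (hP : ∀ᵐ x ∂unitMeasure, ∀ k ∈ Ioo k₁ k₂, P x k) :
    ∀ᵐ z ∂rectMeasure k₁ k₂, P z.1 z.2 := by
  have h1 : ∀ᵐ z ∂rectMeasure k₁ k₂, ∀ k ∈ Ioo k₁ k₂, P z.1 k :=
    Measure.quasiMeasurePreserving_fst.ae hP
  filter_upwards [h1, ae_rect_mem] with z hz hm
  exact hz _ hm.2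

theorem memLp_slice {f : ℝ × ℝ → ℂ} (hf : MemLp f 2 (rectMeasure k₁ k₂)) :
    ∀ᵐ x ∂unitMeasure, MemLp (fun k => f (x, k)) 2 (volume.restrict (Ioo k₁ k₂)) := by
  have h2 := (memLp_two_iff_integrable_sq_norm hf.1).1 hf
  filter_upwards [h2.prod_right_ae, hf.1.prodMk_left] with x hx hm
  exact (memLp_two_iff_integrable_sq_norm hm).2 hx

theorem tailIntegral_eq (f : ℝ × ℝ → ℂ) (x : ℝ) {k : ℝ} (hk : k ∈ Ioo k₁ k₂) :
    tailIntegral k₂ f (x, k) = ∫ τ in Ioo k k₂, f (x, τ) := by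
  rw [tailIntegral, intervalIntegral.integral_of_le hk.2.le, integral_Ioc_eq_integral_Ioo]

theorem tailIntegral_congr {f g : ℝ × ℝ → ℂ} (h : f =ᵐ[rectMeasure k₁ k₂] g) :
    tailIntegral k₂ f =ᵐ[rectMeasure k₁ k₂] tailIntegral k₂ g := by
  refine ae_rect_of_ae_ae (P := fun x k => tailIntegral k₂ f (x, k) = tailIntegral k₂ g (x, k)) ?_
  filter_upwards [Measure.ae_ae_of_ae_prod h] with x hx k hk
  rw [tailIntegral_eq f x hk, tailIntegral_eq g x hk]
  exact integral_congr_ae (ae_restrict_of_ae_restrict_of_subset (Ioo_subset_Ioo_left hk.1.le) hx)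

theorem tailIntegral_add {f g : ℝ × ℝ → ℂ} (hf : MemLp f 2 (rectMeasure k₁ k₂))
    (hg : MemLp g 2 (rectMeasure k₁ k₂)) :
    tailIntegral k₂ (fun z => f z + g z) =ᵐ[rectMeasure k₁ k₂]
      fun z => tailIntegral k₂ f z + tailIntegral k₂ g z := by
  refine ae_rect_of_ae_ae (P := fun x k => tailIntegral k₂ (fun z => f z + g z) (x, k)
    = tailIntegral k₂ f (x, k) + tailIntegral k₂ g (x, k)) ?_
  filter_upwards [memLp_slice hf, memLp_slice hg] with x hx hy k hk
  rw [tailIntegral_eq _ x hk, tailIntegral_eq _ x hk, tailIntegral_eq _ x hk]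
  have hs : Ioo k k₂ ⊆ Ioo k₁ k₂ := Ioo_subset_Ioo_left hk.1.le
  exact integral_add (IntegrableOn.mono_set (hx.integrable (by norm_num)) hs)
    (IntegrableOn.mono_set (hy.integrable (by norm_num)) hs)

theorem tailIntegral_smul (a : ℝ) (f : ℝ × ℝ → ℂ) (z : ℝ × ℝ) :
    tailIntegral k₂ (fun z => a • f z) z = a • tailIntegral k₂ f z := by
  simp only [tailIntegral]
  exact intervalIntegral.integral_smul _ _

theorem aestronglyMeasurable_tailIntegral {f : ℝ × ℝ → ℂ}
    (hf : AEStronglyMeasurable f (rectMeasure k₁ k₂)) :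
    AEStronglyMeasurable (tailIntegral k₂ f) (rectMeasure k₁ k₂) := by
  obtain ⟨f₀, h₀, e⟩ := hf
  refine AEStronglyMeasurable.congr ?_ (tailIntegral_congr e.symm)
  have hm : StronglyMeasurable (fun y : (ℝ × ℝ) × ℝ =>
      {y : (ℝ × ℝ) × ℝ | y.1.2 < y.2 ∧ y.2 < k₂}.indicator (fun y => f₀ (y.1.1, y.2)) y) := by
    refine StronglyMeasurable.indicator (h₀.comp_measurable (by fun_prop)) ?_
    exact (measurableSet_lt (measurable_snd.comp measurable_fst) measurable_snd).inter
      (measurableSet_lt measurable_snd measurable_const)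
  have hI := hm.integral_prod_right' (ν := (volume : Measure ℝ))
  refine hI.aestronglyMeasurable.congr ?_
  filter_upwards [ae_rect_mem] with z hz
  have hz' : tailIntegral k₂ f₀ z = _ := tailIntegral_eq f₀ z.1 hz.2
  rw [hz', ← integral_indicator measurableSet_Ioo]
  rfl

theorem norm_tailIntegral_sq_le {f : ℝ × ℝ → ℂ} (hf : MemLp f 2 (rectMeasure k₁ k₂)) :
    ∀ᵐ x ∂unitMeasure, ∀ k ∈ Ioo k₁ k₂, ‖tailIntegral k₂ f (x, k)‖ ^ 2
      ≤ (k₂ - k₁) * ∫ τ in Ioo k₁ k₂, ‖f (x, τ)‖ ^ 2 := by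
  filter_upwards [memLp_slice hf] with x hx k hk
  have hk12 : k₁ ≤ k₂ := (hk.1.trans hk.2).le
  rw [tailIntegral_eq f x hk]
  have h1 : ‖∫ τ in Ioo k k₂, f (x, τ)‖ ≤ ∫ τ in Ioo k₁ k₂, 1 * ‖f (x, τ)‖ := by
    refine (norm_integral_le_integral_norm _).trans ?_
    simp only [one_mul]
    exact setIntegral_mono_set (hx.integrable (by norm_num)).norm
      (Eventually.of_forall fun _ => norm_nonneg _)
      (Ioo_subset_Ioo_left hk.1.le).eventuallyLE
  have h2 := integral_mul_sq_le (memLp_const (1 : ℝ)) hx.norm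
  calc _ ≤ (∫ τ in Ioo k₁ k₂, 1 * ‖f (x, τ)‖) ^ 2 := by gcongr
    _ ≤ _ := h2
    _ = _ := by simp [hk12]

/-! ### The Carleman estimate for an indefinite integral -/

/-- The pointwise Carleman estimate in one variable: Cauchy-Schwarz for
`e^{-λ x} ∫_0^x g = ∫_0^x (g(y) e^{-λ y}) e^{-λ (x - y)} dy`. -/
theorem norm_primitive_sq_mul_exp_le {g : ℝ → ℂ} (hg : MemLp g 2 unitMeasure) {lam c : ℝ}
    (hc : ∀ x ∈ Ioo (0 : ℝ) 1, Real.exp (-2 * lam * x) * ∫ y in (0 : ℝ)..x,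
      Real.exp (2 * lam * y) ≤ c) {x : ℝ} (hx : x ∈ Ioo (0 : ℝ) 1) :
    ‖∫ y in (0 : ℝ)..x, g y‖ ^ 2 * Real.exp (-2 * lam * x)
      ≤ c * ∫ y, ‖g y‖ ^ 2 * Real.exp (-2 * lam * y) ∂unitMeasure := by
  have hs : Ioo 0 x ⊆ Ioo (0 : ℝ) 1 := Ioo_subset_Ioo_right hx.2.le
  have hgx : MemLp g 2 (volume.restrict (Ioo 0 x)) :=
    hg.mono_measure (Measure.restrict_mono hs le_rfl)
  have hexp : ∀ a : ℝ, ∀ {s : Set ℝ}, s ⊆ Ioo (0 : ℝ) 1 → MeasurableSet s →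
      ∀ᵐ y ∂(volume.restrict s), ‖Real.exp (a * y)‖ ≤ Real.exp |a| := by
    intro a s hs hm
    filter_upwards [ae_restrict_mem hm] with y hy
    rw [Real.norm_eq_abs, Real.abs_exp]
    refine Real.exp_le_exp.2 ((le_abs_self _).trans ?_)
    rw [abs_mul, abs_of_pos (hs hy).1]
    exact mul_le_of_le_one_right (abs_nonneg _) (hs hy).2.le
  have hE : ∀ a : ℝ, MemLp (fun y => Real.exp (a * y)) 2 (volume.restrict (Ioo 0 x)) := fun a =>
    MemLp.of_bound (by fun_prop) _ (hexp a hs measurableSet_Ioo)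
  have hgE : MemLp (fun y => ‖g y‖ * Real.exp (-lam * y)) 2 (volume.restrict (Ioo 0 x)) := by
    refine MemLp.of_le_mul (c := Real.exp |-lam|) hgx
      (hgx.1.norm.mul (by fun_prop)) ?_
    filter_upwards [hexp (-lam) hs measurableSet_Ioo] with y hy
    rw [norm_mul, norm_norm, mul_comm]
    gcongr
  have hgI : Integrable (fun y => ‖g y‖ ^ 2 * Real.exp (-2 * lam * y)) unitMeasure := by
    refine Integrable.mul_bdd (c := Real.exp |-2 * lam|) hg.norm.integrable_sq (by fun_prop) ?_
    exact hexp _ Subset.rfl measurableSet_Ioo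
  have h1 : ‖∫ y in (0 : ℝ)..x, g y‖
      ≤ ∫ y in Ioo 0 x, (‖g y‖ * Real.exp (-lam * y)) * Real.exp (lam * y) := by
    rw [intervalIntegral.integral_of_le hx.1.le, integral_Ioc_eq_integral_Ioo]
    refine (norm_integral_le_integral_norm _).trans (le_of_eq ?_)
    congr 1
    funext y
    rw [mul_assoc, ← Real.exp_add]
    simp
  have h2 := integral_mul_sq_le hgE (hE lam)
  have h3 : ∫ y in Ioo 0 x, (‖g y‖ * Real.exp (-lam * y)) ^ 2
      ≤ ∫ y, ‖g y‖ ^ 2 * Real.exp (-2 * lam * y) ∂unitMeasure := by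
    have e : ∀ y, (‖g y‖ * Real.exp (-lam * y)) ^ 2 = ‖g y‖ ^ 2 * Real.exp (-2 * lam * y) := by
      intro y
      rw [mul_pow, ← Real.exp_nat_mul]
      congr 2
      push_cast
      ring
    simp only [e]
    exact setIntegral_mono_set hgI (Eventually.of_forall fun y => by positivity) hs.eventuallyLE
  have h4 : ∫ y in Ioo 0 x, Real.exp (lam * y) ^ 2 = ∫ y in (0 : ℝ)..x, Real.exp (2 * lam * y) := by
    rw [intervalIntegral.integral_of_le hx.1.le, integral_Ioc_eq_integral_Ioo]
    congr 1
    funext y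
    rw [← Real.exp_nat_mul]
    congr 1
    push_cast
    ring
  have h5 : 0 ≤ ∫ y in (0 : ℝ)..x, Real.exp (2 * lam * y) :=
    intervalIntegral.integral_nonneg hx.1.le fun y _ => (Real.exp_pos _).le
  have h6 : 0 ≤ ∫ y, ‖g y‖ ^ 2 * Real.exp (-2 * lam * y) ∂unitMeasure :=
    integral_nonneg fun y => by positivity
  rw [h4] at h2
  calc ‖∫ y in (0 : ℝ)..x, g y‖ ^ 2 * Real.exp (-2 * lam * x)
      ≤ ((∫ y, ‖g y‖ ^ 2 * Real.exp (-2 * lam * y) ∂unitMeasure)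
        * ∫ y in (0 : ℝ)..x, Real.exp (2 * lam * y)) * Real.exp (-2 * lam * x) := by
        refine mul_le_mul_of_nonneg_right ?_ (Real.exp_pos _).le
        exact (pow_le_pow_left₀ (norm_nonneg _) h1 2).trans
          (h2.trans (mul_le_mul_of_nonneg_right h3 h5))
    _ = (Real.exp (-2 * lam * x) * ∫ y in (0 : ℝ)..x, Real.exp (2 * lam * y))
        * ∫ y, ‖g y‖ ^ 2 * Real.exp (-2 * lam * y) ∂unitMeasure := by ring
    _ ≤ _ := mul_le_mul_of_nonneg_right (hc x hx) h6

theorem exp_mul_integral_exp_le {lam : ℝ} (hl : 0 < lam) (x : ℝ) :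
    Real.exp (-2 * lam * x) * ∫ y in (0 : ℝ)..x, Real.exp (2 * lam * y) ≤ 1 / (2 * lam) := by
  have h : ∫ y in (0 : ℝ)..x, Real.exp (2 * lam * y)
      = (Real.exp (2 * lam * x) - 1) / (2 * lam) := by
    rw [intervalIntegral.integral_comp_mul_left (fun y => Real.exp y) (by positivity),
      integral_exp, smul_eq_mul]
    simp only [mul_zero, Real.exp_zero]
    field_simp
  rw [h, mul_div_assoc', mul_sub, ← Real.exp_add]
  gcongr
  have : -2 * lam * x + 2 * lam * x = 0 := by ring
  rw [this, Real.exp_zero, mul_one]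
  linarith [Real.exp_pos (-2 * lam * x)]

/-- The weight `e^{-2 λ x}` is bounded above and below on the rectangle. -/
theorem ae_exp_bounds (lam : ℝ) : ∀ᵐ z ∂rectMeasure k₁ k₂,
    Real.exp (-2 * |lam|) ≤ Real.exp (-2 * lam * z.1) ∧
      Real.exp (-2 * lam * z.1) ≤ Real.exp (2 * |lam|) := by
  filter_upwards [ae_rect_mem] with z hz
  have h : |lam * z.1| ≤ |lam| := by
    rw [abs_mul, abs_of_pos hz.1.1]
    exact mul_le_of_le_one_right (abs_nonneg _) hz.1.2.le
  have := abs_le.1 h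
  constructor <;> refine Real.exp_le_exp.2 ?_ <;> linarith [this.1, this.2]

theorem integrable_mul_weight {f : ℝ × ℝ → ℝ} (hf : Integrable f (rectMeasure k₁ k₂)) (lam : ℝ) :
    Integrable (fun z => f z * Real.exp (-2 * lam * z.1)) (rectMeasure k₁ k₂) := by
  refine hf.mul_bdd (c := Real.exp (2 * |lam|)) (by fun_prop) ?_
  filter_upwards [ae_exp_bounds lam] with z hz
  rw [Real.norm_eq_abs, Real.abs_exp]
  exact hz.2

section primitive

variable {f g : ℝ × ℝ → ℂ}

theorem norm_sq_mul_exp_le_of_primitive (hf : StronglyMeasurable f) (hg : StronglyMeasurable g)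
    (hg2 : MemLp g 2 (rectMeasure k₁ k₂))
    (hfg : ∀ᵐ k ∂(volume.restrict (Ioo k₁ k₂)), ∀ᵐ x ∂unitMeasure,
      f (x, k) = ∫ y in (0 : ℝ)..x, g (y, k)) {lam c : ℝ}
    (hc : ∀ x ∈ Ioo (0 : ℝ) 1, Real.exp (-2 * lam * x) * ∫ y in (0 : ℝ)..x,
      Real.exp (2 * lam * y) ≤ c) :
    ∀ᵐ x ∂unitMeasure, ∀ᵐ k ∂(volume.restrict (Ioo k₁ k₂)),
      ‖f (x, k)‖ ^ 2 * Real.exp (-2 * lam * x)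
        ≤ c * ∫ y, ‖g (y, k)‖ ^ 2 * Real.exp (-2 * lam * y) ∂unitMeasure := by
  have hI : StronglyMeasurable fun k : ℝ =>
      ∫ y, ‖g (y, k)‖ ^ 2 * Real.exp (-2 * lam * y) ∂unitMeasure := by
    have h : StronglyMeasurable fun z : ℝ × ℝ => ‖g z‖ ^ 2 * Real.exp (-2 * lam * z.1) :=
      (hg.norm.pow 2).mul (Measurable.stronglyMeasurable (by fun_prop))
    exact h.integral_prod_left'
  rw [Measure.ae_ae_comm]
  · have h2 := (memLp_two_iff_integrable_sq_norm hg2.1).1 hg2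
    filter_upwards [hfg, h2.prod_left_ae] with k hk h2k
    have hgk : MemLp (fun y => g (y, k)) 2 unitMeasure :=
      (memLp_two_iff_integrable_sq_norm
        (hg.comp_measurable measurable_prodMk_right).aestronglyMeasurable).2 h2k
    filter_upwards [hk, ae_restrict_mem measurableSet_Ioo] with x hx hm
    rw [hx]
    exact norm_primitive_sq_mul_exp_le hgk hc hm
  · refine measurableSet_le ?_ ?_
    · exact ((hf.norm.pow 2).measurable).mul (by fun_prop)
    · exact (hI.measurable.comp measurable_snd).const_mul c

theorem slice_integral_le_of_primitive (hf : StronglyMeasurable f) (hg : StronglyMeasurable g)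
    (hf2 : MemLp f 2 (rectMeasure k₁ k₂)) (hg2 : MemLp g 2 (rectMeasure k₁ k₂))
    (hfg : ∀ᵐ k ∂(volume.restrict (Ioo k₁ k₂)), ∀ᵐ x ∂unitMeasure,
      f (x, k) = ∫ y in (0 : ℝ)..x, g (y, k)) {lam c : ℝ}
    (hc : ∀ x ∈ Ioo (0 : ℝ) 1, Real.exp (-2 * lam * x) * ∫ y in (0 : ℝ)..x,
      Real.exp (2 * lam * y) ≤ c) :
    ∀ᵐ x ∂unitMeasure, (∫ k in Ioo k₁ k₂, ‖f (x, k)‖ ^ 2) * Real.exp (-2 * lam * x)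
      ≤ c * ∫ z, ‖g z‖ ^ 2 * Real.exp (-2 * lam * z.1) ∂rectMeasure k₁ k₂ := by
  have hI : Integrable (fun z => ‖g z‖ ^ 2 * Real.exp (-2 * lam * z.1)) (rectMeasure k₁ k₂) :=
    integrable_mul_weight hg2.norm.integrable_sq lam
  filter_upwards [norm_sq_mul_exp_le_of_primitive hf hg hg2 hfg hc, memLp_slice hf2] with x hx h2
  rw [integral_prod_symm _ hI, ← integral_mul_const, ← integral_const_mul]
  exact integral_mono_ae (h2.norm.integrable_sq.mul_const _) (hI.integral_prod_right.const_mul c) hx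

/-- The Carleman estimate on the rectangle. -/
theorem integral_sq_mul_exp_le_of_primitive (hf : StronglyMeasurable f)
    (hg : StronglyMeasurable g)
    (hf2 : MemLp f 2 (rectMeasure k₁ k₂)) (hg2 : MemLp g 2 (rectMeasure k₁ k₂))
    (hfg : ∀ᵐ k ∂(volume.restrict (Ioo k₁ k₂)), ∀ᵐ x ∂unitMeasure,
      f (x, k) = ∫ y in (0 : ℝ)..x, g (y, k)) {lam c : ℝ}
    (hc : ∀ x ∈ Ioo (0 : ℝ) 1, Real.exp (-2 * lam * x) * ∫ y in (0 : ℝ)..x,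
      Real.exp (2 * lam * y) ≤ c) :
    ∫ z, ‖f z‖ ^ 2 * Real.exp (-2 * lam * z.1) ∂rectMeasure k₁ k₂
      ≤ c * ∫ z, ‖g z‖ ^ 2 * Real.exp (-2 * lam * z.1) ∂rectMeasure k₁ k₂ := by
  have hI : Integrable (fun z => ‖f z‖ ^ 2 * Real.exp (-2 * lam * z.1)) (rectMeasure k₁ k₂) :=
    integrable_mul_weight hf2.norm.integrable_sq lam
  rw [integral_prod _ hI]
  simp only [integral_mul_const]
  have hJ := hI.integral_prod_left
  simp only [integral_mul_const] at hJ
  have := integral_mono_ae hJ (integrable_const _)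
    (slice_integral_le_of_primitive hf hg hf2 hg2 hfg hc)
  simpa using this

/-- The weighted sup bound for the integral in `k` of an indefinite integral in `x`. -/
theorem norm_tailIntegral_sq_mul_exp_le (hf : StronglyMeasurable f) (hg : StronglyMeasurable g)
    (hf2 : MemLp f 2 (rectMeasure k₁ k₂)) (hg2 : MemLp g 2 (rectMeasure k₁ k₂))
    (hfg : ∀ᵐ k ∂(volume.restrict (Ioo k₁ k₂)), ∀ᵐ x ∂unitMeasure,
      f (x, k) = ∫ y in (0 : ℝ)..x, g (y, k)) {lam c : ℝ}
    (hc : ∀ x ∈ Ioo (0 : ℝ) 1, Real.exp (-2 * lam * x) * ∫ y in (0 : ℝ)..x,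
      Real.exp (2 * lam * y) ≤ c) :
    ∀ᵐ z ∂rectMeasure k₁ k₂, ‖tailIntegral k₂ f z‖ ^ 2 * Real.exp (-2 * lam * z.1)
      ≤ (k₂ - k₁) * (c * ∫ z, ‖g z‖ ^ 2 * Real.exp (-2 * lam * z.1) ∂rectMeasure k₁ k₂) := by
  refine ae_rect_of_ae_ae (P := fun x k => ‖tailIntegral k₂ f (x, k)‖ ^ 2 * Real.exp (-2 * lam * x)
    ≤ (k₂ - k₁) * (c * ∫ z, ‖g z‖ ^ 2 * Real.exp (-2 * lam * z.1) ∂rectMeasure k₁ k₂)) ?_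
  filter_upwards [slice_integral_le_of_primitive hf hg hf2 hg2 hfg hc,
    norm_tailIntegral_sq_le hf2] with x hx h2 k hk
  have hk12 : 0 ≤ k₂ - k₁ := by linarith [hk.1, hk.2]
  calc _ ≤ ((k₂ - k₁) * ∫ τ in Ioo k₁ k₂, ‖f (x, τ)‖ ^ 2) * Real.exp (-2 * lam * x) :=
        mul_le_mul_of_nonneg_right (h2 k hk) (Real.exp_pos _).le
    _ = (k₂ - k₁) * ((∫ τ in Ioo k₁ k₂, ‖f (x, τ)‖ ^ 2) * Real.exp (-2 * lam * x)) := by ring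
    _ ≤ _ := mul_le_mul_of_nonneg_left hx hk12

end primitive

/-! ### Elements of `H` -/

theorem spaceH_strong (p : spaceH k₁ k₂) (j : Fin 3) : StronglyMeasurable (p.1 j) :=
  Lp.stronglyMeasurable _

theorem spaceH_memLp (p : spaceH k₁ k₂) (j : Fin 3) : MemLp (p.1 j) 2 (rectMeasure k₁ k₂) :=
  Lp.memLp _

theorem spaceH_add (p h : spaceH k₁ k₂) (j : Fin 3) :
    (p + h).1 j =ᵐ[rectMeasure k₁ k₂] fun z => p.1 j z + h.1 j z :=
  Lp.coeFn_add (p.1 j) (h.1 j)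

theorem spaceH_smul (a : ℝ) (p : spaceH k₁ k₂) (j : Fin 3) :
    (a • p).1 j =ᵐ[rectMeasure k₁ k₂] fun z => a • p.1 j z :=
  Lp.coeFn_smul a (p.1 j)

theorem spaceH_norm_sq (p : spaceH k₁ k₂) :
    ‖p‖ ^ 2 = ∑ j, ∫ z, ‖p.1 j z‖ ^ 2 ∂rectMeasure k₁ k₂ := by
  rw [Submodule.coe_norm, PiLp.norm_sq_eq_of_L2]
  refine Finset.sum_congr rfl fun j _ => ?_
  have h := @inner_self_eq_norm_sq ℂ _ _ _ _ (p.1 j)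
  rw [← h, L2.inner_def, ← integral_re]
  · refine integral_congr_ae (Eventually.of_forall fun z => ?_)
    simp only [inner_self_eq_norm_sq]
  · exact L2.integrable_inner _ _

theorem spaceH_primitive (p : spaceH k₁ k₂) :
    (∀ᵐ k ∂(volume.restrict (Ioo k₁ k₂)), ∀ᵐ x ∂unitMeasure,
      p.1 0 (x, k) = ∫ y in (0 : ℝ)..x, p.1 1 (y, k)) ∧
    ∀ᵐ k ∂(volume.restrict (Ioo k₁ k₂)), ∀ᵐ x ∂unitMeasure,
      p.1 1 (x, k) = ∫ y in (0 : ℝ)..x, p.1 2 (y, k) := by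
  have h : ∀ᵐ k ∂(volume.restrict (Ioo k₁ k₂)),
      IsSobolev 2 (fun j x => p.1 j (x, k)) ∧ HasBoundaryValues (fun x => p.1 0 (x, k)) 0 0 0 := p.2
  have h' := h.mono fun k hk => hk.2.ae_eq_primitive (hk.1.memLp 0) (hk.1.memLp 1)
    (hk.1.memLp 2) (hk.1.weakDeriv 0) (hk.1.weakDeriv 1)
  simp only [zero_add] at h'
  exact ⟨h'.mono fun k hk => hk.1, h'.mono fun k hk => hk.2⟩

/-- The second derivative controls the norm of `H`. -/
theorem spaceH_norm_sq_le (p : spaceH k₁ k₂) :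
    ‖p‖ ^ 2 ≤ 3 * ∫ z, ‖p.1 2 z‖ ^ 2 ∂rectMeasure k₁ k₂ := by
  have hc : ∀ x ∈ Ioo (0 : ℝ) 1, Real.exp (-2 * 0 * x) * ∫ y in (0 : ℝ)..x,
      Real.exp (2 * 0 * y) ≤ 1 := fun x hx => by simpa using hx.2.le
  have h1 := integral_sq_mul_exp_le_of_primitive (spaceH_strong p 0) (spaceH_strong p 1)
    (spaceH_memLp p 0) (spaceH_memLp p 1) (spaceH_primitive p).1 hc
  have h2 := integral_sq_mul_exp_le_of_primitive (spaceH_strong p 1) (spaceH_strong p 2)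
    (spaceH_memLp p 1) (spaceH_memLp p 2) (spaceH_primitive p).2 hc
  simp only [mul_zero, zero_mul, Real.exp_zero, mul_one, one_mul] at h1 h2
  rw [spaceH_norm_sq, Fin.sum_univ_three]
  linarith

end rect

/-! ### The nonlinear operator at a point -/

/-- The value of the operator `L` at frequency `κ`, as a function of the pointwise values of
`q''`, `q'` and `T`. -/
def quadOp (κ : ℝ) (q₂ q₁ T : ℂ) : ℂ :=
  q₂ - 2 * Complex.I * κ * q₁ + 2 * (κ : ℂ) ^ 2 * q₁ * T - 2 * Complex.I * T + 2 * (κ : ℂ) * T ^ 2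

/-- The linear part of the increment of `quadOp` at `(q₁, T)` in the direction `(h₂, h₁, S)`. -/
def quadOpLin (κ : ℝ) (q₁ T h₂ h₁ S : ℂ) : ℂ :=
  h₂ - 2 * Complex.I * κ * h₁ + 2 * (κ : ℂ) ^ 2 * (h₁ * T + q₁ * S) - 2 * Complex.I * S
    + 4 * (κ : ℂ) * T * S

/-- The part of `‖quadOp‖ ^ 2` beyond first order in the increment. -/
def quadOpRem (κ : ℝ) (q₂ q₁ T h₂ h₁ S : ℂ) : ℝ :=
  ‖quadOp κ (q₂ + h₂) (q₁ + h₁) (T + S)‖ ^ 2 - ‖quadOp κ q₂ q₁ T‖ ^ 2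
    - 2 * (starRingEnd ℂ (quadOp κ q₂ q₁ T) * quadOpLin κ q₁ T h₂ h₁ S).re

/-- The coefficient of `‖S‖ ^ 2` in the bound for the lower order terms of `quadOpRem`. -/
def lowerCoeff (K B : ℝ) (q₁ L : ℂ) : ℝ :=
  3 * (2 * K ^ 2) ^ 2 * ‖q₁‖ ^ 2 + 3 * (2 + 4 * K * B) ^ 2 + (2 * K ^ 2 + 2 * K) * ‖L‖ ^ 2 + 2 * K

/-- The lower order terms of `quadOpRem`, which the Carleman estimate absorbs. -/
def lowerTerms (K B : ℝ) (q₁ L h₁ S : ℂ) : ℝ :=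
  (3 * (2 * K + 2 * K ^ 2 * B) ^ 2 + 2 * K ^ 2) * ‖h₁‖ ^ 2 + lowerCoeff K B q₁ L * ‖S‖ ^ 2

theorem norm_quadOp_le {κ K B : ℝ} (h0 : 0 ≤ κ) (hK : κ ≤ K) (q₂ q₁ : ℂ) {T : ℂ} (hT : ‖T‖ ≤ B) :
    ‖quadOp κ q₂ q₁ T‖ ≤ ‖q₂‖ + (2 * K + 2 * K ^ 2 * B) * ‖q₁‖ + (2 * B + 2 * K * B ^ 2) := by
  have hB : 0 ≤ B := (norm_nonneg _).trans hT
  have hK0 : 0 ≤ K := h0.trans hK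
  have h1 : ‖2 * Complex.I * κ * q₁‖ ≤ 2 * K * ‖q₁‖ := by
    simp only [norm_mul, Complex.norm_I, Complex.norm_ofNat, Complex.norm_real, Real.norm_eq_abs,
      abs_of_nonneg h0, mul_one]
    gcongr
  have h2 : ‖2 * (κ : ℂ) ^ 2 * q₁ * T‖ ≤ 2 * K ^ 2 * ‖q₁‖ * B := by
    simp only [norm_mul, norm_pow, Complex.norm_ofNat, Complex.norm_real, Real.norm_eq_abs,
      abs_of_nonneg h0]
    gcongr
  have h3 : ‖2 * Complex.I * T‖ ≤ 2 * B := by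
    simp only [norm_mul, Complex.norm_I, Complex.norm_ofNat, mul_one]
    gcongr
  have h4 : ‖2 * (κ : ℂ) * T ^ 2‖ ≤ 2 * K * B ^ 2 := by
    simp only [norm_mul, norm_pow, Complex.norm_ofNat, Complex.norm_real, Real.norm_eq_abs,
      abs_of_nonneg h0]
    gcongr
  unfold quadOp
  refine (norm_add_le _ _).trans ?_
  refine (add_le_add (norm_sub_le _ _) h4).trans ?_
  linarith [norm_add_le (q₂ - 2 * Complex.I * κ * q₁) (2 * (κ : ℂ) ^ 2 * q₁ * T),
    norm_sub_le q₂ (2 * Complex.I * κ * q₁)]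

theorem norm_quadOpLin_le {κ K B : ℝ} (h0 : 0 ≤ κ) (hK : κ ≤ K) (q₁ h₂ h₁ S : ℂ) {T : ℂ}
    (hT : ‖T‖ ≤ B) :
    ‖quadOpLin κ q₁ T h₂ h₁ S‖ ≤ ‖h₂‖ + (2 * K + 2 * K ^ 2 * B) * ‖h₁‖
      + (2 * K ^ 2 * ‖q₁‖ + (2 + 4 * K * B)) * ‖S‖ := by
  have hB : 0 ≤ B := (norm_nonneg _).trans hT
  have hK0 : 0 ≤ K := h0.trans hK
  have h1 : ‖2 * Complex.I * κ * h₁‖ ≤ 2 * K * ‖h₁‖ := by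
    simp only [norm_mul, Complex.norm_I, Complex.norm_ofNat, Complex.norm_real, Real.norm_eq_abs,
      abs_of_nonneg h0, mul_one]
    gcongr
  have h2 : ‖2 * (κ : ℂ) ^ 2 * (h₁ * T + q₁ * S)‖ ≤ 2 * K ^ 2 * (‖h₁‖ * B + ‖q₁‖ * ‖S‖) := by
    simp only [norm_mul, norm_pow, Complex.norm_ofNat, Complex.norm_real, Real.norm_eq_abs,
      abs_of_nonneg h0]
    gcongr
    refine (norm_add_le _ _).trans ?_
    rw [norm_mul, norm_mul]
    gcongr
  have h3 : ‖2 * Complex.I * S‖ = 2 * ‖S‖ := by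
    simp only [norm_mul, Complex.norm_I, Complex.norm_ofNat, mul_one]
  have h4 : ‖4 * (κ : ℂ) * T * S‖ ≤ 4 * K * B * ‖S‖ := by
    simp only [norm_mul, Complex.norm_ofNat, Complex.norm_real, Real.norm_eq_abs,
      abs_of_nonneg h0]
    gcongr
  unfold quadOpLin
  refine (norm_add_le _ _).trans ?_
  refine (add_le_add (norm_sub_le _ _) h4).trans ?_
  linarith [norm_add_le (h₂ - 2 * Complex.I * κ * h₁) (2 * (κ : ℂ) ^ 2 * (h₁ * T + q₁ * S)),
    norm_sub_le h₂ (2 * Complex.I * κ * h₁)]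

/-- Two-sided bound for the remainder: with `A` and `N` the linear and the quadratic part of the
increment of the operator, the remainder is `‖A + N‖ ^ 2 + 2 Re (conj L * N)`, and `A + N` is `h₂`
up to terms with a factor `h₁` or `S`. -/
theorem quadOpRem_bounds {κ K B : ℝ} (h0 : 0 ≤ κ) (hK : κ ≤ K) (q₂ q₁ h₂ h₁ : ℂ) {T S : ℂ}
    (hT : ‖T‖ ≤ B) (hTS : ‖T + S‖ ≤ B) :
    ‖h₂‖ ^ 2 / 2 - lowerTerms K B q₁ (quadOp κ q₂ q₁ T) h₁ S ≤ quadOpRem κ q₂ q₁ T h₂ h₁ S ∧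
      quadOpRem κ q₂ q₁ T h₂ h₁ S
        ≤ 2 * ‖h₂‖ ^ 2 + 2 * lowerTerms K B q₁ (quadOp κ q₂ q₁ T) h₁ S := by
  have hB : 0 ≤ B := (norm_nonneg _).trans hT
  have hK0 : 0 ≤ K := h0.trans hK
  set L := quadOp κ q₂ q₁ T with hL
  set A := quadOpLin κ q₁ T h₂ h₁ S with hA
  set N : ℂ := 2 * (κ : ℂ) ^ 2 * h₁ * S + 2 * κ * S ^ 2 with hN
  set E : ℂ := - (2 * Complex.I * κ * h₁) + 2 * (κ : ℂ) ^ 2 * (h₁ * (T + S) + q₁ * S)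
    - 2 * Complex.I * S + 2 * κ * S * (T + (T + S)) with hE
  have e1 : quadOp κ (q₂ + h₂) (q₁ + h₁) (T + S) = L + (A + N) := by
    simp only [hL, hA, hN, quadOp, quadOpLin]; ring
  have e2 : A + N = h₂ + E := by
    simp only [hA, hN, hE, quadOpLin]; ring
  have e3 : quadOpRem κ q₂ q₁ T h₂ h₁ S = ‖h₂ + E‖ ^ 2 + 2 * (starRingEnd ℂ L * N).re := by
    rw [quadOpRem, e1, ← hL, ← hA, ← e2]
    simp only [← Complex.normSq_eq_norm_sq, Complex.normSq_apply, Complex.add_re, Complex.add_im,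
      Complex.mul_re, Complex.conj_re, Complex.conj_im]
    ring
  have hN' : ‖N‖ ≤ 2 * K ^ 2 * ‖h₁‖ * ‖S‖ + 2 * K * ‖S‖ ^ 2 := by
    refine (norm_add_le _ _).trans ?_
    simp only [norm_mul, norm_pow, Complex.norm_ofNat, Complex.norm_real, Real.norm_eq_abs,
      abs_of_nonneg h0]
    gcongr
  have hE' : ‖E‖ ≤ (2 * K + 2 * K ^ 2 * B) * ‖h₁‖ + 2 * K ^ 2 * (‖q₁‖ * ‖S‖)
      + (2 + 4 * K * B) * ‖S‖ := by
    have a1 : ‖-(2 * Complex.I * κ * h₁)‖ ≤ 2 * K * ‖h₁‖ := by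
      simp only [norm_neg, norm_mul, Complex.norm_I, Complex.norm_ofNat, Complex.norm_real,
        Real.norm_eq_abs, abs_of_nonneg h0, mul_one]
      gcongr
    have a2 : ‖2 * (κ : ℂ) ^ 2 * (h₁ * (T + S) + q₁ * S)‖
        ≤ 2 * K ^ 2 * (‖h₁‖ * B + ‖q₁‖ * ‖S‖) := by
      rw [norm_mul, norm_mul, norm_pow, Complex.norm_ofNat, Complex.norm_real, Real.norm_eq_abs,
        abs_of_nonneg h0]
      gcongr
      refine (norm_add_le _ _).trans ?_
      rw [norm_mul, norm_mul]
      gcongr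
    have a3 : ‖2 * Complex.I * S‖ = 2 * ‖S‖ := by
      simp only [norm_mul, Complex.norm_I, Complex.norm_ofNat, mul_one]
    have a4 : ‖2 * (κ : ℂ) * S * (T + (T + S))‖ ≤ 2 * K * ‖S‖ * (B + B) := by
      rw [norm_mul, norm_mul, norm_mul, Complex.norm_ofNat, Complex.norm_real, Real.norm_eq_abs,
        abs_of_nonneg h0]
      gcongr
      exact (norm_add_le _ _).trans (add_le_add hT hTS)
    refine (norm_add_le _ _).trans ?_
    refine (add_le_add (norm_sub_le _ _) a4).trans ?_
    linarith [norm_add_le (-(2 * Complex.I * κ * h₁)) (2 * (κ : ℂ) ^ 2 * (h₁ * (T + S) + q₁ * S))]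
  have hEsq : ‖E‖ ^ 2 ≤ 3 * ((2 * K + 2 * K ^ 2 * B) ^ 2 * ‖h₁‖ ^ 2
      + (2 * K ^ 2) ^ 2 * (‖q₁‖ ^ 2 * ‖S‖ ^ 2) + (2 + 4 * K * B) ^ 2 * ‖S‖ ^ 2) := by
    have three : ∀ a b c : ℝ, (a + b + c) ^ 2 ≤ 3 * (a ^ 2 + b ^ 2 + c ^ 2) := fun a b c => by
      nlinarith [sq_nonneg (a - b), sq_nonneg (b - c), sq_nonneg (a - c)]
    refine (pow_le_pow_left₀ (norm_nonneg _) hE' 2).trans ((three _ _ _).trans (le_of_eq ?_))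
    ring
  have hLN : |2 * (starRingEnd ℂ L * N).re| ≤ 2 * K ^ 2 * (‖h₁‖ ^ 2 + ‖L‖ ^ 2 * ‖S‖ ^ 2)
      + 2 * K * ((1 + ‖L‖ ^ 2) * ‖S‖ ^ 2) := by
    have a1 : |(starRingEnd ℂ L * N).re| ≤ ‖L‖ * ‖N‖ := by
      refine (Complex.abs_re_le_norm _).trans ?_
      rw [norm_mul, RCLike.norm_conj]
    have a2 : ‖L‖ * ‖N‖ ≤ ‖L‖ * (2 * K ^ 2 * ‖h₁‖ * ‖S‖ + 2 * K * ‖S‖ ^ 2) := by gcongr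
    have a3 : 2 * K ^ 2 * (2 * ‖h₁‖ * (‖L‖ * ‖S‖)) ≤ 2 * K ^ 2 * (‖h₁‖ ^ 2 + (‖L‖ * ‖S‖) ^ 2) := by
      gcongr
      exact two_mul_le_add_sq _ _
    have a4 : 2 * K * ((2 * 1 * ‖L‖) * ‖S‖ ^ 2) ≤ 2 * K * ((1 ^ 2 + ‖L‖ ^ 2) * ‖S‖ ^ 2) := by
      gcongr
      exact two_mul_le_add_sq _ _
    rw [abs_mul, abs_two]
    nlinarith [a1, a2, a3, a4]
  have hLN2 := abs_le.1 hLN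
  have u1 : ‖h₂ + E‖ ^ 2 ≤ 2 * ‖h₂‖ ^ 2 + 2 * ‖E‖ ^ 2 := by
    have := pow_le_pow_left₀ (norm_nonneg _) (norm_add_le h₂ E) 2
    nlinarith [sq_nonneg (‖h₂‖ - ‖E‖)]
  have u2 : ‖h₂‖ ^ 2 ≤ 2 * ‖h₂ + E‖ ^ 2 + 2 * ‖E‖ ^ 2 := by
    have h := norm_sub_le (h₂ + E) E
    rw [add_sub_cancel_right] at h
    have := pow_le_pow_left₀ (norm_nonneg _) h 2
    nlinarith [sq_nonneg (‖h₂ + E‖ - ‖E‖)]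
  rw [e3, lowerTerms, lowerCoeff]
  set X := ‖h₁‖ ^ 2
  set Y := ‖S‖ ^ 2
  have hX : 0 ≤ X := sq_nonneg _
  have hY : 0 ≤ Y := sq_nonneg _
  have hp1 : 0 ≤ 2 * K ^ 2 * (X + ‖L‖ ^ 2 * Y) := by positivity
  have hp2 : 0 ≤ 2 * K * ((1 + ‖L‖ ^ 2) * Y) := by positivity
  constructor
  · linarith [hLN2.1]
  · linarith [hLN2.2]

/-! ### Integrated form -/

section integrated

variable {α : Type*} [MeasurableSpace α] {μ : Measure α} {w : α → ℝ} {K B : ℝ}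
  {q₁ L h₂ h₁ S : α → ℂ} {s σ : ℝ}

theorem integrable_lowerCoeff [IsFiniteMeasure μ] (hq : MemLp q₁ 2 μ) (hL : MemLp L 2 μ) :
    Integrable (fun a => lowerCoeff K B (q₁ a) (L a)) μ := by
  have h1 : Integrable (fun a => ‖q₁ a‖ ^ 2) μ := hq.norm.integrable_sq
  have h2 : Integrable (fun a => ‖L a‖ ^ 2) μ := hL.norm.integrable_sq
  exact (((h1.const_mul _).add (integrable_const _)).add (h2.const_mul _)).add (integrable_const _)

theorem lowerCoeff_nonneg (hK : 0 ≤ K) (a b : ℂ) : 0 ≤ lowerCoeff K B a b := by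
  unfold lowerCoeff
  positivity

/-- The integral bound for the lower order terms, from a sup bound for `S` and an `L^2` bound for
`h₁`, both weighted. -/
theorem lowerTerms_integral_le [IsFiniteMeasure μ] (hK : 0 ≤ K) (hw : ∀ a, 0 ≤ w a)
    (hwm : AEStronglyMeasurable w μ) (hq : MemLp q₁ 2 μ) (hL : MemLp L 2 μ)
    (hSm : AEStronglyMeasurable S μ)
    (hh1 : Integrable (fun a => ‖h₁ a‖ ^ 2 * w a) μ) (hS : ∀ᵐ a ∂μ, ‖S a‖ ^ 2 * w a ≤ s)
    (hσ : ∫ a, ‖h₁ a‖ ^ 2 * w a ∂μ ≤ σ) :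
    Integrable (fun a => lowerTerms K B (q₁ a) (L a) (h₁ a) (S a) * w a) μ ∧
    ∫ a, lowerTerms K B (q₁ a) (L a) (h₁ a) (S a) * w a ∂μ
      ≤ (3 * (2 * K + 2 * K ^ 2 * B) ^ 2 + 2 * K ^ 2) * σ
        + s * ∫ a, lowerCoeff K B (q₁ a) (L a) ∂μ := by
  set c := 3 * (2 * K + 2 * K ^ 2 * B) ^ 2 + 2 * K ^ 2 with hc
  have hc0 : 0 ≤ c := by positivity
  have hG := integrable_lowerCoeff (K := K) (B := B) hq hL
  have hSw : Integrable (fun a => lowerCoeff K B (q₁ a) (L a) * (‖S a‖ ^ 2 * w a)) μ := by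
    refine hG.mul_bdd (c := s) ((hSm.norm.pow 2).mul hwm) ?_
    filter_upwards [hS] with a ha
    rwa [Real.norm_eq_abs, abs_of_nonneg (mul_nonneg (sq_nonneg _) (hw a))]
  have e : (fun a => lowerTerms K B (q₁ a) (L a) (h₁ a) (S a) * w a)
      = fun a => c * (‖h₁ a‖ ^ 2 * w a) + lowerCoeff K B (q₁ a) (L a) * (‖S a‖ ^ 2 * w a) := by
    funext a
    rw [lowerTerms, ← hc]
    ring
  rw [e]
  refine ⟨(hh1.const_mul c).add hSw, ?_⟩
  rw [integral_add (hh1.const_mul c) hSw, integral_const_mul]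
  refine add_le_add (mul_le_mul_of_nonneg_left hσ hc0) ?_
  rw [← integral_const_mul]
  refine integral_mono_ae hSw (hG.const_mul s) ?_
  filter_upwards [hS] with a ha
  have := mul_le_mul_of_nonneg_left ha (lowerCoeff_nonneg (B := B) hK (q₁ a) (L a))
  linarith

end integrated

/-! ### The operator on `H` for bounded data -/

/-- The functions `p₀`, `p₁`, `V'` that enter the operator are measurable and bounded. -/
structure IsBoundedData (k₁ k₂ P B : ℝ) (p₀ p₁ V' : ℝ → ℂ) : Prop where
  meas₀ : AEStronglyMeasurable p₀ (volume.restrict (Ioo k₁ k₂))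
  meas₁ : AEStronglyMeasurable p₁ (volume.restrict (Ioo k₁ k₂))
  measV : AEStronglyMeasurable V' unitMeasure
  bound₀ : ∀ k ∈ Ioo k₁ k₂, ‖p₀ k‖ ≤ P
  bound₁ : ∀ k ∈ Ioo k₁ k₂, ‖p₁ k‖ ≤ P
  boundV : ∀ᵐ x ∂unitMeasure, ‖V' x‖ ≤ B

theorem deriv_lift (p₀ p₁ : ℝ → ℂ) (k : ℝ) : deriv (fun y => lift p₀ p₁ y k) = fun x : ℝ =>
    ((4 * x * (x ^ 2 - 1) : ℝ) : ℂ) * p₀ k + ((5 * x ^ 4 - 6 * x ^ 2 + 1 : ℝ) : ℂ) * p₁ k := by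
  funext x
  have h : HasDerivAt (fun y : ℝ => (y : ℂ)) 1 x := Complex.ofRealCLM.hasDerivAt
  have h2 := (((h.pow 2).sub_const 1).pow 2)
  have h3 := (h2.mul_const (p₀ k)).add ((h.mul h2).mul_const (p₁ k))
  refine (h3.congr_deriv ?_).deriv
  push_cast
  simp only [Pi.pow_apply]
  ring

theorem iteratedDeriv_lift (p₀ p₁ : ℝ → ℂ) (k x : ℝ) :
    iteratedDeriv 2 (fun y => lift p₀ p₁ y k) x
      = ((12 * x ^ 2 - 4 : ℝ) : ℂ) * p₀ k + ((20 * x ^ 3 - 12 * x : ℝ) : ℂ) * p₁ k := by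
  rw [iteratedDeriv_succ, iteratedDeriv_one, deriv_lift]
  have h1 : HasDerivAt (fun x : ℝ => 4 * x * (x ^ 2 - 1)) (12 * x ^ 2 - 4) x := by
    have := ((hasDerivAt_id x).const_mul 4).mul (((hasDerivAt_id x).pow 2).sub_const 1)
    refine this.congr_deriv ?_
    simp
    ring
  have h2 : HasDerivAt (fun x : ℝ => 5 * x ^ 4 - 6 * x ^ 2 + 1) (20 * x ^ 3 - 12 * x) x := by
    have := ((((hasDerivAt_id x).pow 4).const_mul 5).sub
      (((hasDerivAt_id x).pow 2).const_mul 6)).add_const 1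
    refine this.congr_deriv ?_
    simp
    ring
  exact ((h1.ofReal_comp.mul_const (p₀ k)).add (h2.ofReal_comp.mul_const (p₁ k))).deriv

section bounded

variable {k₁ k₂ P B : ℝ} {p₀ p₁ V' : ℝ → ℂ}

theorem rectMeasure_real (h : k₁ ≤ k₂) : (rectMeasure k₁ k₂).real univ = k₂ - k₁ := by
  rw [rectMeasure, ← univ_prod_univ, measureReal_prod_prod]
  simp [h]

theorem norm_combination_le {P a b A B : ℝ} {u v : ℂ} (hu : ‖u‖ ≤ P) (hv : ‖v‖ ≤ P)
    (ha : |a| ≤ A) (hb : |b| ≤ B) : ‖(a : ℂ) * u + (b : ℂ) * v‖ ≤ (A + B) * P := by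
  refine (norm_add_le _ _).trans ?_
  rw [norm_mul, norm_mul, Complex.norm_real, Complex.norm_real, Real.norm_eq_abs, Real.norm_eq_abs,
    add_mul]
  have hA : 0 ≤ A := (abs_nonneg _).trans ha
  have hB : 0 ≤ B := (abs_nonneg _).trans hb
  gcongr

theorem integral_sq_add_le (hk : k₁ ≤ k₂) {f g : ℝ × ℝ → ℂ} {c : ℝ}
    (hf : MemLp f 2 (rectMeasure k₁ k₂)) (hg : AEStronglyMeasurable g (rectMeasure k₁ k₂))
    (hc : ∀ᵐ z ∂rectMeasure k₁ k₂, ‖g z‖ ≤ c) :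
    ∫ z, ‖f z + g z‖ ^ 2 ∂rectMeasure k₁ k₂
      ≤ 2 * ∫ z, ‖f z‖ ^ 2 ∂rectMeasure k₁ k₂ + 2 * c ^ 2 * (k₂ - k₁) := by
  have h2 : Integrable (fun z => ‖f z‖ ^ 2) (rectMeasure k₁ k₂) := hf.norm.integrable_sq
  have hfg : Integrable (fun z => ‖f z + g z‖ ^ 2) (rectMeasure k₁ k₂) :=
    (hf.add (MemLp.of_bound hg _ hc)).norm.integrable_sq
  calc _ ≤ ∫ z, (2 * ‖f z‖ ^ 2 + 2 * c ^ 2) ∂rectMeasure k₁ k₂ := by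
        refine integral_mono_ae hfg ((h2.const_mul 2).add (integrable_const _)) ?_
        filter_upwards [hc] with z hz
        have h3 := pow_le_pow_left₀ (norm_nonneg _) (norm_add_le (f z) (g z)) 2
        have h4 := pow_le_pow_left₀ (norm_nonneg _) hz 2
        nlinarith [sq_nonneg (‖f z‖ - ‖g z‖)]
    _ = _ := by
        rw [integral_add (h2.const_mul 2) (integrable_const _), integral_const_mul, integral_const,
          rectMeasure_real hk, smul_eq_mul]
        ring

theorem integral_component_le (p : spaceH k₁ k₂) (j : Fin 3) :
    ∫ z, ‖p.1 j z‖ ^ 2 ∂rectMeasure k₁ k₂ ≤ ‖p‖ ^ 2 := by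
  rw [spaceH_norm_sq]
  exact Finset.single_le_sum (f := fun j => ∫ z, ‖p.1 j z‖ ^ 2 ∂rectMeasure k₁ k₂)
    (fun i _ => integral_nonneg fun z => sq_nonneg _) (Finset.mem_univ j)

theorem norm_tailIntegral_component_sq_le (p : spaceH k₁ k₂) (hk : k₁ ≤ k₂) :
    ∀ᵐ z ∂rectMeasure k₁ k₂, ‖tailIntegral k₂ (p.1 1) z‖ ^ 2 ≤ (k₂ - k₁) * ‖p‖ ^ 2 := by
  have hc : ∀ x ∈ Ioo (0 : ℝ) 1, Real.exp (-2 * 0 * x) * ∫ y in (0 : ℝ)..x,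
      Real.exp (2 * 0 * y) ≤ 1 := fun x hx => by simpa using hx.2.le
  have h := norm_tailIntegral_sq_mul_exp_le (spaceH_strong p 1) (spaceH_strong p 2)
    (spaceH_memLp p 1) (spaceH_memLp p 2) (spaceH_primitive p).2 hc
  simp only [mul_zero, zero_mul, Real.exp_zero, mul_one, one_mul] at h
  filter_upwards [h] with z hz
  exact hz.trans (mul_le_mul_of_nonneg_left (integral_component_le p 2) (by linarith))

theorem norm_tailIntegral_component_le (p : spaceH k₁ k₂) (hk : k₁ ≤ k₂) :
    ∀ᵐ z ∂rectMeasure k₁ k₂, ‖tailIntegral k₂ (p.1 1) z‖ ≤ (1 + (k₂ - k₁)) * ‖p‖ := by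
  filter_upwards [norm_tailIntegral_component_sq_le p hk] with z hz
  refine le_of_sq_le_sq (hz.trans ?_) (mul_nonneg (by linarith) (norm_nonneg _))
  rw [mul_pow]
  refine mul_le_mul_of_nonneg_right ?_ (sq_nonneg _)
  nlinarith

theorem inner₁_eq (p : spaceH k₁ k₂) (z : ℝ × ℝ) : inner₁ p₀ p₁ V' p z.1 z.2
    = -tailIntegral k₂ (fun z => first p₀ p₁ p z.1 z.2) z + V' z.1 := rfl

theorem first_add (p h : spaceH k₁ k₂) : ∀ᵐ z ∂rectMeasure k₁ k₂,
    first p₀ p₁ (p + h) z.1 z.2 = first p₀ p₁ p z.1 z.2 + h.1 1 z := by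
  filter_upwards [spaceH_add p h 1] with z hz
  have hz' : (p + h).1 1 (z.1, z.2) = p.1 1 z + h.1 1 z := hz
  rw [first, hz', first]
  ring

theorem second_add (p h : spaceH k₁ k₂) : ∀ᵐ z ∂rectMeasure k₁ k₂,
    second p₀ p₁ (p + h) z.1 z.2 = second p₀ p₁ p z.1 z.2 + h.1 2 z := by
  filter_upwards [spaceH_add p h 2] with z hz
  have hz' : (p + h).1 2 (z.1, z.2) = p.1 2 z + h.1 2 z := hz
  rw [second, hz', second]
  ring

theorem opL_eq (p : spaceH k₁ k₂) (z : ℝ × ℝ) : opL p₀ p₁ V' p z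
    = quadOp z.2 (second p₀ p₁ p z.1 z.2) (first p₀ p₁ p z.1 z.2)
      (inner₁ p₀ p₁ V' p z.1 z.2) := rfl

theorem sq_add_add_le (a b c : ℝ) : (a + b + c) ^ 2 ≤ 3 * (a ^ 2 + b ^ 2 + c ^ 2) := by
  nlinarith [sq_nonneg (a - b), sq_nonneg (b - c), sq_nonneg (a - c)]

namespace IsBoundedData

theorem meas_combination (hd : IsBoundedData k₁ k₂ P B p₀ p₁ V') {a b : ℝ → ℝ} (ha : Continuous a) (hb : Continuous b) :
    AEStronglyMeasurable (fun z : ℝ × ℝ => ((a z.1 : ℝ) : ℂ) * p₀ z.2 + ((b z.1 : ℝ) : ℂ) * p₁ z.2)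
      (rectMeasure k₁ k₂) := by
  have h0 : AEStronglyMeasurable (fun z : ℝ × ℝ => p₀ z.2) (rectMeasure k₁ k₂) := hd.meas₀.comp_snd
  have h1 : AEStronglyMeasurable (fun z : ℝ × ℝ => p₁ z.2) (rectMeasure k₁ k₂) := hd.meas₁.comp_snd
  have ha' : Continuous fun z : ℝ × ℝ => ((a z.1 : ℝ) : ℂ) := by fun_prop
  have hb' : Continuous fun z : ℝ × ℝ => ((b z.1 : ℝ) : ℂ) := by fun_prop
  exact (ha'.aestronglyMeasurable.mul h0).add (hb'.aestronglyMeasurable.mul h1)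

/-- The factor `16 = 4 + 12` adds bounds for the two polynomials in `deriv_lift` on `(0, 1)`. -/
theorem lift₁_bound (hd : IsBoundedData k₁ k₂ P B p₀ p₁ V') : AEStronglyMeasurable (fun z : ℝ × ℝ => deriv (fun y => lift p₀ p₁ y z.2) z.1)
      (rectMeasure k₁ k₂) ∧
    ∀ᵐ z ∂rectMeasure k₁ k₂, ‖deriv (fun y => lift p₀ p₁ y z.2) z.1‖ ≤ 16 * P := by
  simp only [deriv_lift]
  refine ⟨hd.meas_combination (a := fun x => 4 * x * (x ^ 2 - 1))
    (b := fun x => 5 * x ^ 4 - 6 * x ^ 2 + 1) (by fun_prop) (by fun_prop), ?_⟩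
  filter_upwards [ae_rect_mem] with z hz
  obtain ⟨h0, h1⟩ := hz.1
  have h2 : z.1 ^ 2 ≤ 1 := pow_le_one₀ h0.le h1.le
  have h4 : z.1 ^ 4 ≤ 1 := pow_le_one₀ h0.le h1.le
  have h2' : 0 ≤ z.1 ^ 2 := by positivity
  have h4' : 0 ≤ z.1 ^ 4 := by positivity
  have ha : |4 * z.1 * (z.1 ^ 2 - 1)| ≤ 4 := abs_le.2 ⟨by nlinarith, by nlinarith⟩
  have hb : |5 * z.1 ^ 4 - 6 * z.1 ^ 2 + 1| ≤ 12 := abs_le.2 ⟨by linarith, by linarith⟩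
  have h := norm_combination_le (hd.bound₀ _ hz.2) (hd.bound₁ _ hz.2) ha hb
  refine h.trans (le_of_eq ?_)
  norm_num

/-- The factor `48 = 16 + 32` adds bounds for the two polynomials in `iteratedDeriv_lift` on
`(0, 1)`. -/
theorem lift₂_bound (hd : IsBoundedData k₁ k₂ P B p₀ p₁ V') :
    AEStronglyMeasurable (fun z : ℝ × ℝ => iteratedDeriv 2 (fun y => lift p₀ p₁ y z.2) z.1)
      (rectMeasure k₁ k₂) ∧
    ∀ᵐ z ∂rectMeasure k₁ k₂, ‖iteratedDeriv 2 (fun y => lift p₀ p₁ y z.2) z.1‖ ≤ 48 * P := by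
  simp only [iteratedDeriv_lift]
  refine ⟨hd.meas_combination (a := fun x => 12 * x ^ 2 - 4)
    (b := fun x => 20 * x ^ 3 - 12 * x) (by fun_prop) (by fun_prop), ?_⟩
  filter_upwards [ae_rect_mem] with z hz
  obtain ⟨h0, h1⟩ := hz.1
  have h2 : z.1 ^ 2 ≤ 1 := pow_le_one₀ h0.le h1.le
  have h4 : z.1 ^ 3 ≤ 1 := pow_le_one₀ h0.le h1.le
  have h2' : 0 ≤ z.1 ^ 2 := by positivity
  have h4' : 0 ≤ z.1 ^ 3 := by positivity
  have ha : |12 * z.1 ^ 2 - 4| ≤ 16 := abs_le.2 ⟨by linarith, by linarith⟩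
  have hb : |20 * z.1 ^ 3 - 12 * z.1| ≤ 32 := abs_le.2 ⟨by linarith, by linarith⟩
  have h := norm_combination_le (hd.bound₀ _ hz.2) (hd.bound₁ _ hz.2) ha hb
  refine h.trans (le_of_eq ?_)
  norm_num

theorem memLp_lift₁ (hd : IsBoundedData k₁ k₂ P B p₀ p₁ V') : MemLp (fun z : ℝ × ℝ => deriv (fun y => lift p₀ p₁ y z.2) z.1) 2
    (rectMeasure k₁ k₂) :=
  MemLp.of_bound hd.lift₁_bound.1 _ hd.lift₁_bound.2

theorem memLp_first (hd : IsBoundedData k₁ k₂ P B p₀ p₁ V') (p : spaceH k₁ k₂) :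
    MemLp (fun z : ℝ × ℝ => first p₀ p₁ p z.1 z.2) 2 (rectMeasure k₁ k₂) :=
  (spaceH_memLp p 1).add hd.memLp_lift₁

theorem memLp_second (hd : IsBoundedData k₁ k₂ P B p₀ p₁ V') (p : spaceH k₁ k₂) :
    MemLp (fun z : ℝ × ℝ => second p₀ p₁ p z.1 z.2) 2 (rectMeasure k₁ k₂) :=
  (spaceH_memLp p 2).add (MemLp.of_bound hd.lift₂_bound.1 _ hd.lift₂_bound.2)

theorem integral_first_sq_le (hd : IsBoundedData k₁ k₂ P B p₀ p₁ V') (hk : k₁ ≤ k₂) (p : spaceH k₁ k₂) :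
    ∫ z, ‖first p₀ p₁ p z.1 z.2‖ ^ 2 ∂rectMeasure k₁ k₂
      ≤ 2 * ‖p‖ ^ 2 + 2 * (16 * P) ^ 2 * (k₂ - k₁) := by
  refine (integral_sq_add_le hk (spaceH_memLp p 1) hd.lift₁_bound.1 hd.lift₁_bound.2).trans ?_
  linarith [integral_component_le p 1]

theorem integral_second_sq_le (hd : IsBoundedData k₁ k₂ P B p₀ p₁ V') (hk : k₁ ≤ k₂) (p : spaceH k₁ k₂) :
    ∫ z, ‖second p₀ p₁ p z.1 z.2‖ ^ 2 ∂rectMeasure k₁ k₂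
      ≤ 2 * ‖p‖ ^ 2 + 2 * (48 * P) ^ 2 * (k₂ - k₁) := by
  refine (integral_sq_add_le hk (spaceH_memLp p 2) hd.lift₂_bound.1 hd.lift₂_bound.2).trans ?_
  linarith [integral_component_le p 2]

theorem meas_inner₁ (hd : IsBoundedData k₁ k₂ P B p₀ p₁ V') (p : spaceH k₁ k₂) :
    AEStronglyMeasurable (fun z : ℝ × ℝ => inner₁ p₀ p₁ V' p z.1 z.2) (rectMeasure k₁ k₂) :=
  (aestronglyMeasurable_tailIntegral (hd.memLp_first p).1).neg.add hd.measV.comp_fst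

theorem norm_tailIntegral_lift_le (hd : IsBoundedData k₁ k₂ P B p₀ p₁ V') : ∀ᵐ z ∂rectMeasure k₁ k₂,
    ‖tailIntegral k₂ (fun z => deriv (fun y => lift p₀ p₁ y z.2) z.1) z‖
      ≤ 16 * P * (k₂ - k₁) := by
  refine ae_rect_of_ae_ae (P := fun x k =>
    ‖tailIntegral k₂ (fun z => deriv (fun y => lift p₀ p₁ y z.2) z.1) (x, k)‖
      ≤ 16 * P * (k₂ - k₁)) ?_
  filter_upwards [Measure.ae_ae_of_ae_prod hd.lift₁_bound.2] with x hx k hk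
  have hP : 0 ≤ P := (norm_nonneg _).trans (hd.bound₀ k hk)
  rw [tailIntegral_eq _ x hk]
  have h := norm_integral_le_of_norm_le_const (μ := volume.restrict (Ioo k k₂))
    (ae_restrict_of_ae_restrict_of_subset (Ioo_subset_Ioo_left hk.1.le) hx)
  refine h.trans ?_
  have : (volume.restrict (Ioo k k₂)).real univ = k₂ - k := by simp [hk.2.le]
  rw [this]
  exact mul_le_mul_of_nonneg_left (by linarith [hk.1]) (by positivity)

/-- The inner factor `T` is bounded, uniformly on balls of `H`. -/
theorem norm_inner₁_le (hd : IsBoundedData k₁ k₂ P B p₀ p₁ V') (p : spaceH k₁ k₂) (hk : k₁ ≤ k₂) : ∀ᵐ z ∂rectMeasure k₁ k₂,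
    ‖inner₁ p₀ p₁ V' p z.1 z.2‖ ≤ (1 + (k₂ - k₁)) * ‖p‖ + 16 * P * (k₂ - k₁) + B := by
  have hV : ∀ᵐ z ∂rectMeasure k₁ k₂, ‖V' z.1‖ ≤ B :=
    Measure.quasiMeasurePreserving_fst.ae hd.boundV
  filter_upwards [tailIntegral_add (spaceH_memLp p 1) hd.memLp_lift₁, hV,
    hd.norm_tailIntegral_lift_le, norm_tailIntegral_component_le p hk] with z h1 h2 h3 h4
  have e : tailIntegral k₂ (fun z => first p₀ p₁ p z.1 z.2) z = _ := h1
  rw [inner₁_eq, e]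
  refine (norm_add_le _ _).trans ?_
  rw [norm_neg]
  linarith [norm_add_le (tailIntegral k₂ (p.1 1) z)
    (tailIntegral k₂ (fun z => deriv (fun y => lift p₀ p₁ y z.2) z.1) z)]

theorem inner₁_add (hd : IsBoundedData k₁ k₂ P B p₀ p₁ V') (p h : spaceH k₁ k₂) : ∀ᵐ z ∂rectMeasure k₁ k₂,
    inner₁ p₀ p₁ V' (p + h) z.1 z.2
      = inner₁ p₀ p₁ V' p z.1 z.2 + -tailIntegral k₂ (h.1 1) z := by
  filter_upwards [tailIntegral_congr (first_add (p₀ := p₀) (p₁ := p₁) p h),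
    tailIntegral_add (hd.memLp_first p) (spaceH_memLp h 1)] with z h1 h2
  rw [inner₁_eq, inner₁_eq, h1, h2]
  ring

theorem meas_opL (hd : IsBoundedData k₁ k₂ P B p₀ p₁ V') (p : spaceH k₁ k₂) :
    AEStronglyMeasurable (opL p₀ p₁ V' p) (rectMeasure k₁ k₂) := by
  have h1 := (hd.memLp_first p).1
  have h2 := (hd.memLp_second p).1
  have h3 := hd.meas_inner₁ p
  have hκ : AEStronglyMeasurable (fun z : ℝ × ℝ => (z.2 : ℂ)) (rectMeasure k₁ k₂) :=
    (Complex.continuous_ofReal.comp continuous_snd).aestronglyMeasurable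
  exact (((h2.sub ((hκ.const_mul _).mul h1)).add ((((hκ.pow 2).const_mul 2).mul h1).mul h3)).sub
    (h3.const_mul _)).add ((hκ.const_mul 2).mul (h3.pow 2))

/-- The operator maps `H` to `L^2`, and balls to bounded sets. -/
theorem memLp_opL (hd : IsBoundedData k₁ k₂ P B p₀ p₁ V') (hk0 : 0 < k₁) (hk : k₁ ≤ k₂) (p : spaceH k₁ k₂) {T : ℝ}
    (hT : (1 + (k₂ - k₁)) * ‖p‖ + 16 * P * (k₂ - k₁) + B ≤ T) :
    MemLp (opL p₀ p₁ V' p) 2 (rectMeasure k₁ k₂) ∧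
    ∫ z, ‖opL p₀ p₁ V' p z‖ ^ 2 ∂rectMeasure k₁ k₂
      ≤ 3 * ((2 * ‖p‖ ^ 2 + 2 * (48 * P) ^ 2 * (k₂ - k₁))
        + (2 * k₂ + 2 * k₂ ^ 2 * T) ^ 2 * (2 * ‖p‖ ^ 2 + 2 * (16 * P) ^ 2 * (k₂ - k₁))
        + (2 * T + 2 * k₂ * T ^ 2) ^ 2 * (k₂ - k₁)) := by
  have hb : ∀ᵐ z ∂rectMeasure k₁ k₂, ‖opL p₀ p₁ V' p z‖ ≤ ‖second p₀ p₁ p z.1 z.2‖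
      + (2 * k₂ + 2 * k₂ ^ 2 * T) * ‖first p₀ p₁ p z.1 z.2‖ + (2 * T + 2 * k₂ * T ^ 2) := by
    filter_upwards [hd.norm_inner₁_le p hk, ae_rect_mem] with z hz hm
    rw [opL_eq]
    exact norm_quadOp_le (hk0.trans hm.2.1).le hm.2.2.le _ _ (hz.trans hT)
  have h1 := (hd.memLp_first p).norm
  have h2 := (hd.memLp_second p).norm
  have hL : MemLp (opL p₀ p₁ V' p) 2 (rectMeasure k₁ k₂) :=
    MemLp.mono' ((h2.add (h1.const_mul (2 * k₂ + 2 * k₂ ^ 2 * T))).add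
      (memLp_const (2 * T + 2 * k₂ * T ^ 2))) (hd.meas_opL p) hb
  refine ⟨hL, ?_⟩
  have i1 := h1.integrable_sq
  have i2 := h2.integrable_sq
  calc _ ≤ ∫ z, 3 * (‖second p₀ p₁ p z.1 z.2‖ ^ 2
      + (2 * k₂ + 2 * k₂ ^ 2 * T) ^ 2 * ‖first p₀ p₁ p z.1 z.2‖ ^ 2
      + (2 * T + 2 * k₂ * T ^ 2) ^ 2) ∂rectMeasure k₁ k₂ := by
        refine integral_mono_ae hL.norm.integrable_sq
          (((i2.add (i1.const_mul _)).add (integrable_const _)).const_mul 3) ?_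
        filter_upwards [hb] with z hz
        refine (pow_le_pow_left₀ (norm_nonneg _) hz 2).trans ((sq_add_add_le _ _ _).trans ?_)
        rw [mul_pow]
    _ = 3 * (∫ z, ‖second p₀ p₁ p z.1 z.2‖ ^ 2 ∂rectMeasure k₁ k₂
      + (2 * k₂ + 2 * k₂ ^ 2 * T) ^ 2 * ∫ z, ‖first p₀ p₁ p z.1 z.2‖ ^ 2 ∂rectMeasure k₁ k₂
      + (2 * T + 2 * k₂ * T ^ 2) ^ 2 * (k₂ - k₁)) := by
        have i3 : Integrable (fun z : ℝ × ℝ => ‖second p₀ p₁ p z.1 z.2‖ ^ 2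
          + (2 * k₂ + 2 * k₂ ^ 2 * T) ^ 2 * ‖first p₀ p₁ p z.1 z.2‖ ^ 2) (rectMeasure k₁ k₂) :=
          i2.add (i1.const_mul _)
        rw [integral_const_mul, integral_add i3 (integrable_const _),
          integral_add i2 (i1.const_mul _), integral_const_mul, integral_const,
          rectMeasure_real hk, smul_eq_mul]
        ring
    _ ≤ _ := by
        gcongr
        · exact hd.integral_second_sq_le hk p
        · exact hd.integral_first_sq_le hk p

end IsBoundedData

end bounded

/-! ### Differentiability and convexity of the functional -/

/-- The linearization of `opL` at `p` in the direction `h`. -/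
def opLin (p₀ p₁ V' : ℝ → ℂ) {k₁ k₂ : ℝ} (p h : spaceH k₁ k₂) (z : ℝ × ℝ) : ℂ :=
  quadOpLin z.2 (first p₀ p₁ p z.1 z.2) (inner₁ p₀ p₁ V' p z.1 z.2) (h.1 2 z) (h.1 1 z)
    (-tailIntegral k₂ (h.1 1) z)

/-- The part of `‖opL‖ ^ 2` beyond first order in the increment `h`. -/
def opRem (p₀ p₁ V' : ℝ → ℂ) {k₁ k₂ : ℝ} (p h : spaceH k₁ k₂) (z : ℝ × ℝ) : ℝ :=
  quadOpRem z.2 (second p₀ p₁ p z.1 z.2) (first p₀ p₁ p z.1 z.2) (inner₁ p₀ p₁ V' p z.1 z.2)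
    (h.1 2 z) (h.1 1 z) (-tailIntegral k₂ (h.1 1) z)

/-- The first variation of `costJ lam` at `p` in the direction `h`. -/
def costVariation (p₀ p₁ V' : ℝ → ℂ) {k₁ k₂ : ℝ} (lam : ℝ) (p h : spaceH k₁ k₂) : ℝ :=
  Real.exp (2 * lam) * ∫ z, 2 * (starRingEnd ℂ (opL p₀ p₁ V' p z) * opLin p₀ p₁ V' p h z).re
    * Real.exp (-2 * lam * z.1) ∂rectMeasure k₁ k₂

section bounded

variable {k₁ k₂ P B : ℝ} {p₀ p₁ V' : ℝ → ℂ}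

theorem opLin_add (p h g : spaceH k₁ k₂) : ∀ᵐ z ∂rectMeasure k₁ k₂,
    opLin p₀ p₁ V' p (h + g) z = opLin p₀ p₁ V' p h z + opLin p₀ p₁ V' p g z := by
  filter_upwards [spaceH_add h g 1, spaceH_add h g 2, tailIntegral_congr (spaceH_add h g 1),
    tailIntegral_add (spaceH_memLp h 1) (spaceH_memLp g 1)] with z h1 h2 h3 h4
  rw [opLin, opLin, opLin, h1, h2, h3, h4, quadOpLin, quadOpLin, quadOpLin]
  ring

theorem opLin_smul (a : ℝ) (p h : spaceH k₁ k₂) : ∀ᵐ z ∂rectMeasure k₁ k₂,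
    opLin p₀ p₁ V' p (a • h) z = a • opLin p₀ p₁ V' p h z := by
  filter_upwards [spaceH_smul a h 1, spaceH_smul a h 2,
    tailIntegral_congr (spaceH_smul a h 1)] with z h1 h2 h3
  rw [opLin, opLin, h1, h2, h3, tailIntegral_smul, quadOpLin, quadOpLin]
  simp only [Complex.real_smul]
  ring

namespace IsBoundedData

theorem meas_opLin (hd : IsBoundedData k₁ k₂ P B p₀ p₁ V') (p h : spaceH k₁ k₂) :
    AEStronglyMeasurable (opLin p₀ p₁ V' p h) (rectMeasure k₁ k₂) := by
  have h1 := (hd.memLp_first p).1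
  have h3 := hd.meas_inner₁ p
  have hκ : AEStronglyMeasurable (fun z : ℝ × ℝ => (z.2 : ℂ)) (rectMeasure k₁ k₂) :=
    (Complex.continuous_ofReal.comp continuous_snd).aestronglyMeasurable
  have g1 := (spaceH_memLp h 1).1
  have g2 := (spaceH_memLp h 2).1
  have gS := (aestronglyMeasurable_tailIntegral (spaceH_memLp h 1).1).neg
  exact (((g2.sub ((hκ.const_mul _).mul g1)).add (((hκ.pow 2).const_mul 2).mul
    ((g1.mul h3).add (h1.mul gS)))).sub (gS.const_mul _)).add (((hκ.const_mul 4).mul h3).mul gS)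

/-- The linearization maps `H` boundedly to `L^2`; the terms with `S` use its sup bound, as `p'` is
only square integrable. -/
theorem memLp_opLin (hd : IsBoundedData k₁ k₂ P B p₀ p₁ V') (hk0 : 0 < k₁) (hk : k₁ ≤ k₂)
    (p : spaceH k₁ k₂) : ∃ K : ℝ, 0 ≤ K ∧ ∀ h : spaceH k₁ k₂,
      MemLp (opLin p₀ p₁ V' p h) 2 (rectMeasure k₁ k₂) ∧
        ∫ z, ‖opLin p₀ p₁ V' p h z‖ ^ 2 ∂rectMeasure k₁ k₂ ≤ K * ‖h‖ ^ 2 := by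
  set T := (1 + (k₂ - k₁)) * ‖p‖ + 16 * P * (k₂ - k₁) + B with hT
  set a := 2 * k₂ + 2 * k₂ ^ 2 * T with ha
  set F : ℝ × ℝ → ℝ := fun z => 2 * k₂ ^ 2 * ‖first p₀ p₁ p z.1 z.2‖ + (2 + 4 * k₂ * T) with hF
  have hFm : MemLp F 2 (rectMeasure k₁ k₂) :=
    ((hd.memLp_first p).norm.const_mul _).add (memLp_const _)
  have hF2 : Integrable (fun z => F z ^ 2) (rectMeasure k₁ k₂) := hFm.integrable_sq
  have hF0 : 0 ≤ ∫ z, F z ^ 2 ∂rectMeasure k₁ k₂ := integral_nonneg fun z => sq_nonneg _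
  have hk' : 0 ≤ k₂ - k₁ := sub_nonneg.2 hk
  refine ⟨3 * (1 + a ^ 2 + (k₂ - k₁) * ∫ z, F z ^ 2 ∂rectMeasure k₁ k₂), by positivity,
    fun h => ?_⟩
  have hb : ∀ᵐ z ∂rectMeasure k₁ k₂, ‖opLin p₀ p₁ V' p h z‖ ^ 2 ≤ 3 * (‖h.1 2 z‖ ^ 2
      + a ^ 2 * ‖h.1 1 z‖ ^ 2 + F z ^ 2 * ((k₂ - k₁) * ‖h‖ ^ 2)) := by
    filter_upwards [hd.norm_inner₁_le p hk, ae_rect_mem,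
      norm_tailIntegral_component_sq_le h hk] with z hz hm hS
    have h1 := norm_quadOpLin_le (hk0.trans hm.2.1).le hm.2.2.le (first p₀ p₁ p z.1 z.2)
      (h.1 2 z) (h.1 1 z) (-tailIntegral k₂ (h.1 1) z) hz
    refine (pow_le_pow_left₀ (norm_nonneg _) h1 2).trans ((sq_add_add_le _ _ _).trans ?_)
    rw [mul_pow, mul_pow, norm_neg]
    gcongr
  have i1 : Integrable (fun z => ‖h.1 1 z‖ ^ 2) (rectMeasure k₁ k₂) :=
    (spaceH_memLp h 1).norm.integrable_sq
  have i2 : Integrable (fun z => ‖h.1 2 z‖ ^ 2) (rectMeasure k₁ k₂) :=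
    (spaceH_memLp h 2).norm.integrable_sq
  have i3 : Integrable (fun z => ‖h.1 2 z‖ ^ 2 + a ^ 2 * ‖h.1 1 z‖ ^ 2) (rectMeasure k₁ k₂) :=
    i2.add (i1.const_mul _)
  have i4 : Integrable (fun z => 3 * (‖h.1 2 z‖ ^ 2
      + a ^ 2 * ‖h.1 1 z‖ ^ 2 + F z ^ 2 * ((k₂ - k₁) * ‖h‖ ^ 2))) (rectMeasure k₁ k₂) :=
    (i3.add (hF2.mul_const _)).const_mul 3
  have hA := hd.meas_opLin p h
  have i5 : Integrable (fun z => ‖opLin p₀ p₁ V' p h z‖ ^ 2) (rectMeasure k₁ k₂) := by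
    refine i4.mono' (hA.norm.pow 2) ?_
    filter_upwards [hb] with z hz
    rwa [Real.norm_eq_abs, abs_of_nonneg (sq_nonneg _)]
  refine ⟨(memLp_two_iff_integrable_sq_norm hA).2 i5, (integral_mono_ae i5 i4 hb).trans ?_⟩
  rw [integral_const_mul, integral_add i3 (hF2.mul_const _), integral_add i2 (i1.const_mul _),
    integral_const_mul, integral_mul_const]
  have := integral_component_le h 1
  have := integral_component_le h 2
  have : a ^ 2 * ∫ z, ‖h.1 1 z‖ ^ 2 ∂rectMeasure k₁ k₂ ≤ a ^ 2 * ‖h‖ ^ 2 := by gcongr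
  linarith

theorem integrable_variation (hd : IsBoundedData k₁ k₂ P B p₀ p₁ V') (hk0 : 0 < k₁)
    (hk : k₁ ≤ k₂) (p h : spaceH k₁ k₂) :
    Integrable (fun z => 2 * (starRingEnd ℂ (opL p₀ p₁ V' p z) * opLin p₀ p₁ V' p h z).re)
      (rectMeasure k₁ k₂) := by
  obtain ⟨K, -, hK⟩ := hd.memLp_opLin hk0 hk p
  have hc : MemLp (fun z => starRingEnd ℂ (opL p₀ p₁ V' p z)) 2 (rectMeasure k₁ k₂) :=
    (hd.memLp_opL hk0 hk p le_rfl).1.star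
  have h1 : Integrable (fun z => starRingEnd ℂ (opL p₀ p₁ V' p z) * opLin p₀ p₁ V' p h z)
    (rectMeasure k₁ k₂) := hc.integrable_mul (hK h).1
  exact h1.re.const_mul 2

/-- The first variation is a continuous linear functional of the direction. -/
theorem exists_clm_variation (hd : IsBoundedData k₁ k₂ P B p₀ p₁ V') (hk0 : 0 < k₁)
    (hk : k₁ ≤ k₂) (lam : ℝ) (p : spaceH k₁ k₂) :
    ∃ D : spaceH k₁ k₂ →L[ℝ] ℝ, ∀ h, D h = costVariation p₀ p₁ V' lam p h := by
  obtain ⟨K, hK0, hK⟩ := hd.memLp_opLin hk0 hk p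
  have hL := (hd.memLp_opL hk0 hk p le_rfl).1
  have hI := fun h => integrable_mul_weight (hd.integrable_variation hk0 hk p h) lam
  let D : spaceH k₁ k₂ →ₗ[ℝ] ℝ :=
    { toFun := costVariation p₀ p₁ V' lam p
      map_add' := by
        intro h g
        unfold costVariation
        rw [← mul_add, ← integral_add (hI h) (hI g)]
        congr 1
        refine integral_congr_ae ?_
        filter_upwards [opLin_add (p₀ := p₀) (p₁ := p₁) (V' := V') p h g] with z hz
        rw [hz, mul_add, Complex.add_re]
        ring
      map_smul' := by
        intro a h
        unfold costVariation
        rw [RingHom.id_apply, smul_eq_mul, mul_left_comm, ← integral_const_mul a]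
        congr 1
        refine integral_congr_ae ?_
        filter_upwards [opLin_smul (p₀ := p₀) (p₁ := p₁) (V' := V') a p h] with z hz
        rw [hz, Complex.real_smul, mul_left_comm, Complex.re_ofReal_mul]
        ring }
  set L2 := ∫ z, ‖opL p₀ p₁ V' p z‖ ^ 2 ∂rectMeasure k₁ k₂ with hL2
  have hL20 : 0 ≤ L2 := integral_nonneg fun z => sq_nonneg _
  refine ⟨D.mkContinuous (Real.exp (2 * lam) * (2 * √(L2 * K) * Real.exp (2 * |lam|))) ?_,
    fun h => rfl⟩
  intro h
  change ‖costVariation p₀ p₁ V' lam p h‖ ≤ _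
  have hLn : MemLp (fun z => ‖opL p₀ p₁ V' p z‖) 2 (rectMeasure k₁ k₂) := hL.norm
  have hAn : MemLp (fun z => ‖opLin p₀ p₁ V' p h z‖) 2 (rectMeasure k₁ k₂) := (hK h).1.norm
  have hprod : Integrable (fun z => ‖opL p₀ p₁ V' p z‖ * ‖opLin p₀ p₁ V' p h z‖)
    (rectMeasure k₁ k₂) := hLn.integrable_mul hAn
  have hcs : ∫ z, ‖opL p₀ p₁ V' p z‖ * ‖opLin p₀ p₁ V' p h z‖ ∂rectMeasure k₁ k₂
      ≤ √(L2 * K) * ‖h‖ := by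
    refine le_of_sq_le_sq ((integral_mul_sq_le hLn hAn).trans ?_) (by positivity)
    rw [mul_pow, Real.sq_sqrt (by positivity), mul_assoc]
    exact mul_le_mul_of_nonneg_left (hK h).2 hL20
  rw [costVariation, norm_mul, Real.norm_eq_abs, Real.abs_exp, mul_assoc]
  refine mul_le_mul_of_nonneg_left ?_ (Real.exp_pos _).le
  refine (norm_integral_le_integral_norm _).trans ?_
  calc _ ≤ ∫ z, (2 * Real.exp (2 * |lam|)) * (‖opL p₀ p₁ V' p z‖ * ‖opLin p₀ p₁ V' p h z‖)
        ∂rectMeasure k₁ k₂ := by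
        refine integral_mono_ae (hI h).norm (hprod.const_mul _) ?_
        filter_upwards [ae_exp_bounds lam] with z hz
        have h1 : |(starRingEnd ℂ (opL p₀ p₁ V' p z) * opLin p₀ p₁ V' p h z).re|
            ≤ ‖opL p₀ p₁ V' p z‖ * ‖opLin p₀ p₁ V' p h z‖ := by
          refine (Complex.abs_re_le_norm _).trans ?_
          rw [norm_mul, RCLike.norm_conj]
        rw [Real.norm_eq_abs, abs_mul, abs_mul, abs_two, Real.abs_exp]
        calc _ ≤ 2 * (‖opL p₀ p₁ V' p z‖ * ‖opLin p₀ p₁ V' p h z‖) * Real.exp (2 * |lam|) := by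
              exact mul_le_mul (by gcongr) hz.2 (Real.exp_pos _).le (by positivity)
          _ = _ := by ring
    _ ≤ _ := by
        rw [integral_const_mul]
        refine (mul_le_mul_of_nonneg_left hcs (by positivity)).trans (le_of_eq ?_)
        ring

theorem opRem_ae_eq (hd : IsBoundedData k₁ k₂ P B p₀ p₁ V') (p h : spaceH k₁ k₂) :
    ∀ᵐ z ∂rectMeasure k₁ k₂, opRem p₀ p₁ V' p h z = ‖opL p₀ p₁ V' (p + h) z‖ ^ 2
      - ‖opL p₀ p₁ V' p z‖ ^ 2
      - 2 * (starRingEnd ℂ (opL p₀ p₁ V' p z) * opLin p₀ p₁ V' p h z).re := by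
  filter_upwards [hd.inner₁_add p h, first_add (p₀ := p₀) (p₁ := p₁) p h,
    second_add (p₀ := p₀) (p₁ := p₁) p h] with z h1 h2 h3
  rw [opL_eq (p + h), h1, h2, h3]
  rfl

theorem integrable_opRem (hd : IsBoundedData k₁ k₂ P B p₀ p₁ V') (hk0 : 0 < k₁) (hk : k₁ ≤ k₂)
    (p h : spaceH k₁ k₂) : Integrable (opRem p₀ p₁ V' p h) (rectMeasure k₁ k₂) := by
  have h1 := (hd.memLp_opL hk0 hk (p + h) le_rfl).1.norm.integrable_sq
  have h2 := (hd.memLp_opL hk0 hk p le_rfl).1.norm.integrable_sq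
  exact ((h1.sub h2).sub (hd.integrable_variation hk0 hk p h)).congr
    ((hd.opRem_ae_eq p h).mono fun z hz => hz.symm)

/-- Taylor's formula for the functional. -/
theorem costJ_add (hd : IsBoundedData k₁ k₂ P B p₀ p₁ V') (hk0 : 0 < k₁) (hk : k₁ ≤ k₂)
    (lam : ℝ) (p h : spaceH k₁ k₂) :
    costJ p₀ p₁ V' lam (p + h) - costJ p₀ p₁ V' lam p - costVariation p₀ p₁ V' lam p h
      = Real.exp (2 * lam) * ∫ z, opRem p₀ p₁ V' p h z * Real.exp (-2 * lam * z.1)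
        ∂rectMeasure k₁ k₂ := by
  have h1 := integrable_mul_weight
    (hd.memLp_opL hk0 hk (p + h) le_rfl).1.norm.integrable_sq lam
  have h2 := integrable_mul_weight (hd.memLp_opL hk0 hk p le_rfl).1.norm.integrable_sq lam
  have h3 := integrable_mul_weight (hd.integrable_variation hk0 hk p h) lam
  rw [costJ, costJ, costVariation, ← mul_sub, ← mul_sub, ← integral_sub h1 h2]
  have h12 : Integrable (fun z => ‖opL p₀ p₁ V' (p + h) z‖ ^ 2 * Real.exp (-2 * lam * z.1)
    - ‖opL p₀ p₁ V' p z‖ ^ 2 * Real.exp (-2 * lam * z.1)) (rectMeasure k₁ k₂) := h1.sub h2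
  rw [← integral_sub h12 h3]
  congr 1
  refine integral_congr_ae ?_
  filter_upwards [hd.opRem_ae_eq p h] with z hz
  rw [hz]
  ring

/-- The remainder in Taylor's formula is comparable with the weighted norm of `h''`, up to lower
order terms with the factor `c` of the Carleman estimate. -/
theorem integral_opRem_bounds (hd : IsBoundedData k₁ k₂ P B p₀ p₁ V') (hk0 : 0 < k₁)
    (hk : k₁ ≤ k₂) {lam c T G Q : ℝ} (hc0 : 0 ≤ c)
    (hc : ∀ x ∈ Ioo (0 : ℝ) 1, Real.exp (-2 * lam * x) * ∫ y in (0 : ℝ)..x,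
      Real.exp (2 * lam * y) ≤ c) (p h : spaceH k₁ k₂)
    (hT : (1 + (k₂ - k₁)) * ‖p‖ + 16 * P * (k₂ - k₁) + B ≤ T)
    (hT' : (1 + (k₂ - k₁)) * ‖p + h‖ + 16 * P * (k₂ - k₁) + B ≤ T)
    (hG : ∫ z, lowerCoeff k₂ T (first p₀ p₁ p z.1 z.2) (opL p₀ p₁ V' p z) ∂rectMeasure k₁ k₂ ≤ G)
    (hQ : ∫ z, ‖h.1 2 z‖ ^ 2 * Real.exp (-2 * lam * z.1) ∂rectMeasure k₁ k₂ = Q) :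
    Q / 2 - (3 * (2 * k₂ + 2 * k₂ ^ 2 * T) ^ 2 + 2 * k₂ ^ 2 + (k₂ - k₁) * G) * (c * Q)
        ≤ ∫ z, opRem p₀ p₁ V' p h z * Real.exp (-2 * lam * z.1) ∂rectMeasure k₁ k₂ ∧
      ∫ z, opRem p₀ p₁ V' p h z * Real.exp (-2 * lam * z.1) ∂rectMeasure k₁ k₂
        ≤ 2 * Q + 2 * ((3 * (2 * k₂ + 2 * k₂ ^ 2 * T) ^ 2 + 2 * k₂ ^ 2 + (k₂ - k₁) * G)
          * (c * Q)) := by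
  have hk20 : 0 ≤ k₂ := hk0.le.trans hk
  have hQ0 : 0 ≤ Q := hQ ▸ integral_nonneg fun z => by positivity
  have hL := (hd.memLp_opL hk0 hk p le_rfl).1
  have hS := norm_tailIntegral_sq_mul_exp_le (spaceH_strong h 1) (spaceH_strong h 2)
    (spaceH_memLp h 1) (spaceH_memLp h 2) (spaceH_primitive h).2 hc
  have hσ := integral_sq_mul_exp_le_of_primitive (spaceH_strong h 1) (spaceH_strong h 2)
    (spaceH_memLp h 1) (spaceH_memLp h 2) (spaceH_primitive h).2 hc
  rw [hQ] at hS hσ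
  have hwm : AEStronglyMeasurable (fun z : ℝ × ℝ => Real.exp (-2 * lam * z.1))
      (rectMeasure k₁ k₂) := by fun_prop
  obtain ⟨hlowI, hlow⟩ := lowerTerms_integral_le (K := k₂) (B := T) hk20
    (w := fun z : ℝ × ℝ => Real.exp (-2 * lam * z.1)) (fun z => (Real.exp_pos _).le) hwm
    (hd.memLp_first p) hL (S := fun z => -tailIntegral k₂ (h.1 1) z)
    (aestronglyMeasurable_tailIntegral (spaceH_memLp h 1).1).neg
    (integrable_mul_weight (spaceH_memLp h 1).norm.integrable_sq lam)
    (by simpa only [norm_neg] using hS) hσ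
  have hlow' : ∫ z, lowerTerms k₂ T (first p₀ p₁ p z.1 z.2) (opL p₀ p₁ V' p z) (h.1 1 z)
      (-tailIntegral k₂ (h.1 1) z) * Real.exp (-2 * lam * z.1) ∂rectMeasure k₁ k₂
      ≤ (3 * (2 * k₂ + 2 * k₂ ^ 2 * T) ^ 2 + 2 * k₂ ^ 2 + (k₂ - k₁) * G) * (c * Q) := by
    refine hlow.trans ?_
    have : (k₂ - k₁) * (c * Q) * ∫ z, lowerCoeff k₂ T (first p₀ p₁ p z.1 z.2)
        (opL p₀ p₁ V' p z) ∂rectMeasure k₁ k₂ ≤ (k₂ - k₁) * (c * Q) * G :=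
      mul_le_mul_of_nonneg_left hG (mul_nonneg (sub_nonneg.2 hk) (mul_nonneg hc0 hQ0))
    linarith
  have hQI : Integrable (fun z => ‖h.1 2 z‖ ^ 2 * Real.exp (-2 * lam * z.1))
    (rectMeasure k₁ k₂) := integrable_mul_weight (spaceH_memLp h 2).norm.integrable_sq lam
  have hRI := integrable_mul_weight (hd.integrable_opRem hk0 hk p h) lam
  have hpt : ∀ᵐ z ∂rectMeasure k₁ k₂, ‖h.1 2 z‖ ^ 2 / 2 - lowerTerms k₂ T
      (first p₀ p₁ p z.1 z.2) (opL p₀ p₁ V' p z) (h.1 1 z) (-tailIntegral k₂ (h.1 1) z)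
        ≤ opRem p₀ p₁ V' p h z ∧ opRem p₀ p₁ V' p h z ≤ 2 * ‖h.1 2 z‖ ^ 2 + 2 * lowerTerms k₂ T
      (first p₀ p₁ p z.1 z.2) (opL p₀ p₁ V' p z) (h.1 1 z) (-tailIntegral k₂ (h.1 1) z) := by
    filter_upwards [ae_rect_mem, hd.norm_inner₁_le p hk, hd.norm_inner₁_le (p + h) hk,
      hd.inner₁_add p h] with z hm h1 h2 h3
    rw [h3] at h2
    exact quadOpRem_bounds (hk0.trans hm.2.1).le hm.2.2.le _ _ _ _ (h1.trans hT) (h2.trans hT')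
  constructor
  · have h1 := integral_mono_ae ((hQI.div_const 2).sub hlowI) hRI (by
      filter_upwards [hpt] with z hz
      have := mul_le_mul_of_nonneg_right hz.1 (Real.exp_pos (-2 * lam * z.1)).le
      simp only [Pi.sub_apply]
      linarith)
    rw [integral_sub' (hQI.div_const 2) hlowI, integral_div, hQ] at h1
    linarith
  · have h1 := integral_mono_ae hRI ((hQI.const_mul 2).add (hlowI.const_mul 2)) (by
      filter_upwards [hpt] with z hz
      have := mul_le_mul_of_nonneg_right hz.2 (Real.exp_pos (-2 * lam * z.1)).le
      simp only [Pi.add_apply]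
      linarith)
    rw [integral_add' (hQI.const_mul 2) (hlowI.const_mul 2), integral_const_mul,
      integral_const_mul, hQ] at h1
    linarith

/-- The functional is Fréchet differentiable, and its derivative is the first variation. -/
theorem hasFDerivAt_costJ (hd : IsBoundedData k₁ k₂ P B p₀ p₁ V') (hk0 : 0 < k₁) (hk : k₁ ≤ k₂)
    (lam : ℝ) (p : spaceH k₁ k₂) : ∃ D : spaceH k₁ k₂ →L[ℝ] ℝ,
      HasFDerivAt (costJ p₀ p₁ V' lam) D p ∧ ∀ h, D h = costVariation p₀ p₁ V' lam p h := by
  obtain ⟨D, hD⟩ := hd.exists_clm_variation hk0 hk lam p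
  refine ⟨D, ?_, hD⟩
  have hk' : 0 ≤ k₂ - k₁ := sub_nonneg.2 hk
  set T := (1 + (k₂ - k₁)) * (‖p‖ + 1) + 16 * P * (k₂ - k₁) + B with hT
  set G := ∫ z, lowerCoeff k₂ T (first p₀ p₁ p z.1 z.2) (opL p₀ p₁ V' p z) ∂rectMeasure k₁ k₂
    with hG
  have hG0 : 0 ≤ G := integral_nonneg fun z => lowerCoeff_nonneg (hk0.le.trans hk) _ _
  set c := Real.exp (2 * |lam|) * Real.exp (2 * |lam|) with hc
  set Γ := 3 * (2 * k₂ + 2 * k₂ ^ 2 * T) ^ 2 + 2 * k₂ ^ 2 + (k₂ - k₁) * G with hΓ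
  have hΓ0 : 0 ≤ Γ := by positivity
  -- The Carleman factor for an arbitrary real parameter, without decay.
  have hcarl : ∀ x ∈ Ioo (0 : ℝ) 1, Real.exp (-2 * lam * x) * ∫ y in (0 : ℝ)..x,
      Real.exp (2 * lam * y) ≤ c := by
    intro x hx
    have hb : ∀ a y : ℝ, |a| ≤ 2 * |lam| → 0 ≤ y → y ≤ 1 →
        Real.exp (a * y) ≤ Real.exp (2 * |lam|) := by
      intro a y ha h0 h1
      refine Real.exp_le_exp.2 ((le_abs_self _).trans ?_)
      rw [abs_mul, abs_of_nonneg h0]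
      nlinarith [abs_nonneg a]
    have h1 : ∫ y in (0 : ℝ)..x, Real.exp (2 * lam * y) ≤ Real.exp (2 * |lam|) := by
      calc _ ≤ ∫ _ in (0 : ℝ)..x, Real.exp (2 * |lam|) := by
            refine intervalIntegral.integral_mono_on hx.1.le
              (Continuous.intervalIntegrable (by fun_prop) _ _)
              (Continuous.intervalIntegrable (by fun_prop) _ _) fun y hy => ?_
            exact hb _ y (by rw [abs_mul, abs_two]) hy.1 (hy.2.trans hx.2.le)
        _ ≤ _ := by
            rw [intervalIntegral.integral_const, sub_zero, smul_eq_mul]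
            exact mul_le_of_le_one_left (Real.exp_pos _).le hx.2.le
    exact mul_le_mul (hb _ x (by rw [abs_mul, abs_neg, abs_two]) hx.1.le hx.2.le) h1
      (intervalIntegral.integral_nonneg hx.1.le fun y _ => (Real.exp_pos _).le) (Real.exp_pos _).le
  have hbig : (fun h => costJ p₀ p₁ V' lam (p + h) - costJ p₀ p₁ V' lam p - D h)
      =O[𝓝 0] fun h : spaceH k₁ k₂ => ‖h‖ ^ 2 := by
    refine Asymptotics.IsBigO.of_bound
      (Real.exp (2 * lam) * ((2 + 2 * Γ * c) * Real.exp (2 * |lam|))) ?_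
    filter_upwards [Metric.closedBall_mem_nhds (0 : spaceH k₁ k₂) one_pos] with h hh
    rw [mem_closedBall_zero_iff] at hh
    set Q := ∫ z, ‖h.1 2 z‖ ^ 2 * Real.exp (-2 * lam * z.1) ∂rectMeasure k₁ k₂ with hQ
    have hQ0 : 0 ≤ Q := integral_nonneg fun z => by positivity
    have i2 : Integrable (fun z => ‖h.1 2 z‖ ^ 2) (rectMeasure k₁ k₂) :=
      (spaceH_memLp h 2).norm.integrable_sq
    have hQh : Q ≤ Real.exp (2 * |lam|) * ‖h‖ ^ 2 := by
      calc Q ≤ ∫ z, Real.exp (2 * |lam|) * ‖h.1 2 z‖ ^ 2 ∂rectMeasure k₁ k₂ := by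
            refine integral_mono_ae (integrable_mul_weight i2 lam) (i2.const_mul _) ?_
            filter_upwards [ae_exp_bounds lam] with z hz
            have := mul_le_mul_of_nonneg_left hz.2 (sq_nonneg ‖h.1 2 z‖)
            linarith
        _ ≤ _ := by
            rw [integral_const_mul]
            gcongr
            exact integral_component_le h 2
    have hT1 : (1 + (k₂ - k₁)) * ‖p‖ + 16 * P * (k₂ - k₁) + B ≤ T := by
      rw [hT]
      gcongr
      linarith
    have hT2 : (1 + (k₂ - k₁)) * ‖p + h‖ + 16 * P * (k₂ - k₁) + B ≤ T := by
      rw [hT]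
      gcongr
      exact (norm_add_le _ _).trans (by linarith)
    obtain ⟨hlo, hhi⟩ := hd.integral_opRem_bounds hk0 hk (G := G) (by positivity) hcarl p h hT1 hT2
      le_rfl hQ.symm
    rw [hD, hd.costJ_add hk0 hk, norm_mul, Real.norm_eq_abs, Real.abs_exp, norm_pow, norm_norm,
      mul_assoc (Real.exp (2 * lam))]
    refine mul_le_mul_of_nonneg_left ?_ (Real.exp_pos _).le
    have hΓc : 0 ≤ Γ * (c * Q) := by positivity
    have habs : ‖∫ z, opRem p₀ p₁ V' p h z * Real.exp (-2 * lam * z.1) ∂rectMeasure k₁ k₂‖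
        ≤ (2 + 2 * Γ * c) * Q := by
      rw [Real.norm_eq_abs]
      refine abs_le.2 ⟨?_, ?_⟩ <;> linarith
    refine habs.trans ((mul_le_mul_of_nonneg_left hQh (by positivity)).trans (le_of_eq ?_))
    ring
  rw [hasFDerivAt_iff_isLittleO_nhds_zero]
  exact hbig.trans_isLittleO (Asymptotics.isLittleO_norm_pow_id one_lt_two)

end IsBoundedData

end bounded

theorem exists_lowerCoeff_bound (k₁ k₂ P B R T : ℝ) (hk0 : 0 < k₁) (hk : k₁ ≤ k₂) :
    ∃ G : ℝ, 0 ≤ G ∧ ∀ (p₀ p₁ V' : ℝ → ℂ), IsBoundedData k₁ k₂ P B p₀ p₁ V' →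
      ∀ p : spaceH k₁ k₂, ‖p‖ ≤ R → (1 + (k₂ - k₁)) * ‖p‖ + 16 * P * (k₂ - k₁) + B ≤ T →
      ∫ z, lowerCoeff k₂ T (first p₀ p₁ p z.1 z.2) (opL p₀ p₁ V' p z) ∂rectMeasure k₁ k₂ ≤ G := by
  have hk' : 0 ≤ k₂ - k₁ := sub_nonneg.2 hk
  have hk20 : 0 ≤ k₂ := hk0.le.trans hk
  set X := 2 * R ^ 2 + 2 * (16 * P) ^ 2 * (k₂ - k₁) with hX
  set Y := 3 * ((2 * R ^ 2 + 2 * (48 * P) ^ 2 * (k₂ - k₁)) + (2 * k₂ + 2 * k₂ ^ 2 * T) ^ 2 * X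
        + (2 * T + 2 * k₂ * T ^ 2) ^ 2 * (k₂ - k₁)) with hY
  refine ⟨3 * (2 * k₂ ^ 2) ^ 2 * X + 3 * (2 + 4 * k₂ * T) ^ 2 * (k₂ - k₁)
    + (2 * k₂ ^ 2 + 2 * k₂) * Y + 2 * k₂ * (k₂ - k₁), by positivity, ?_⟩
  intro p₀ p₁ V' hd p hp hT
  have hp2 : ‖p‖ ^ 2 ≤ R ^ 2 := pow_le_pow_left₀ (norm_nonneg _) hp 2
  obtain ⟨hL, hLY⟩ := hd.memLp_opL hk0 hk p hT
  have hX' : ∫ z, ‖first p₀ p₁ p z.1 z.2‖ ^ 2 ∂rectMeasure k₁ k₂ ≤ X :=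
    (hd.integral_first_sq_le hk p).trans (by rw [hX]; gcongr)
  have hY' : ∫ z, ‖opL p₀ p₁ V' p z‖ ^ 2 ∂rectMeasure k₁ k₂ ≤ Y :=
    hLY.trans (by rw [hY, hX]; gcongr)
  have i1 : Integrable (fun z : ℝ × ℝ => ‖first p₀ p₁ p z.1 z.2‖ ^ 2) (rectMeasure k₁ k₂) :=
    (hd.memLp_first p).norm.integrable_sq
  have i2 : Integrable (fun z => ‖opL p₀ p₁ V' p z‖ ^ 2) (rectMeasure k₁ k₂) :=
    hL.norm.integrable_sq
  have i3 : Integrable (fun z : ℝ × ℝ => 3 * (2 * k₂ ^ 2) ^ 2 * ‖first p₀ p₁ p z.1 z.2‖ ^ 2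
    + 3 * (2 + 4 * k₂ * T) ^ 2) (rectMeasure k₁ k₂) := (i1.const_mul _).add (integrable_const _)
  have i4 : Integrable (fun z : ℝ × ℝ => 3 * (2 * k₂ ^ 2) ^ 2 * ‖first p₀ p₁ p z.1 z.2‖ ^ 2
    + 3 * (2 + 4 * k₂ * T) ^ 2 + (2 * k₂ ^ 2 + 2 * k₂) * ‖opL p₀ p₁ V' p z‖ ^ 2)
    (rectMeasure k₁ k₂) := i3.add (i2.const_mul _)
  unfold lowerCoeff
  rw [integral_add i4 (integrable_const _), integral_add i3 (i2.const_mul _),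
    integral_add (i1.const_mul _) (integrable_const _), integral_const, integral_const,
    integral_const_mul, integral_const_mul, rectMeasure_real hk, smul_eq_mul, smul_eq_mul]
  have a1 := mul_le_mul_of_nonneg_left hX' (by positivity : 0 ≤ 3 * (2 * k₂ ^ 2) ^ 2)
  have a2 := mul_le_mul_of_nonneg_left hY' (by positivity : 0 ≤ 2 * k₂ ^ 2 + 2 * k₂)
  linarith

/-- Strict convexity on a ball: for a large parameter the Carleman factor `1 / (2 λ)` absorbs the
lower order terms. -/
theorem exists_strictConvexity (k₁ k₂ P B R : ℝ) (hk0 : 0 < k₁) (hk : k₁ ≤ k₂) :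
    ∃ lam₀ : ℝ, 1 < lam₀ ∧ ∀ (p₀ p₁ V' : ℝ → ℂ), IsBoundedData k₁ k₂ P B p₀ p₁ V' →
      ∀ lam : ℝ, lam₀ ≤ lam → ∀ p h : spaceH k₁ k₂,
        p ∈ Metric.closedBall 0 R → p + h ∈ Metric.closedBall 0 R →
        1 / 12 * ‖h‖ ^ 2 ≤ costJ p₀ p₁ V' lam (p + h) - costJ p₀ p₁ V' lam p
          - fderiv ℝ (costJ p₀ p₁ V' lam) p h := by
  have hk' : 0 ≤ k₂ - k₁ := sub_nonneg.2 hk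
  set T := (1 + (k₂ - k₁)) * R + 16 * P * (k₂ - k₁) + B with hT
  obtain ⟨G, hG0, hG⟩ := exists_lowerCoeff_bound k₁ k₂ P B R T hk0 hk
  set Γ := 3 * (2 * k₂ + 2 * k₂ ^ 2 * T) ^ 2 + 2 * k₂ ^ 2 + (k₂ - k₁) * G with hΓ
  have hΓ0 : 0 ≤ Γ := by positivity
  refine ⟨2 + 2 * Γ, by linarith, ?_⟩
  intro p₀ p₁ V' hd lam hlam p h hp hph
  rw [mem_closedBall_zero_iff] at hp hph
  have hl0 : 0 < lam := by linarith
  obtain ⟨D, hD, hDv⟩ := hd.hasFDerivAt_costJ hk0 hk lam p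
  have hTp : ∀ q : spaceH k₁ k₂, ‖q‖ ≤ R →
      (1 + (k₂ - k₁)) * ‖q‖ + 16 * P * (k₂ - k₁) + B ≤ T := by
    intro q hq
    rw [hT]
    gcongr
  rw [hD.fderiv, hDv, hd.costJ_add hk0 hk]
  set Q := ∫ z, ‖h.1 2 z‖ ^ 2 * Real.exp (-2 * lam * z.1) ∂rectMeasure k₁ k₂ with hQ
  have hQ0 : 0 ≤ Q := integral_nonneg fun z => by positivity
  have hlow := (hd.integral_opRem_bounds hk0 hk (by positivity)
    (fun x _ => exp_mul_integral_exp_le hl0 x) p h (hTp p hp) (hTp _ hph)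
    (hG p₀ p₁ V' hd p hp (hTp p hp)) hQ.symm).1
  have habs : Γ * (1 / (2 * lam) * Q) ≤ Q / 4 := by
    have : Γ * (1 / (2 * lam)) ≤ 1 / 4 := by
      rw [mul_one_div, div_le_div_iff₀ (by positivity) (by norm_num)]
      linarith
    nlinarith
  have i2 : Integrable (fun z => ‖h.1 2 z‖ ^ 2) (rectMeasure k₁ k₂) :=
    (spaceH_memLp h 2).norm.integrable_sq
  have hQlow : Real.exp (-2 * lam) * ∫ z, ‖h.1 2 z‖ ^ 2 ∂rectMeasure k₁ k₂ ≤ Q := by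
    rw [← integral_const_mul]
    refine integral_mono_ae (i2.const_mul _) (integrable_mul_weight i2 lam) ?_
    filter_upwards [ae_exp_bounds lam] with z hz
    rw [abs_of_pos hl0] at hz
    have := mul_le_mul_of_nonneg_left hz.1 (sq_nonneg ‖h.1 2 z‖)
    linarith
  have hnorm := spaceH_norm_sq_le h
  have hfin : ∫ z, ‖h.1 2 z‖ ^ 2 ∂rectMeasure k₁ k₂ ≤ Real.exp (2 * lam) * Q := by
    have := mul_le_mul_of_nonneg_left hQlow (Real.exp_pos (2 * lam)).le
    rwa [← mul_assoc, ← Real.exp_add, show 2 * lam + -2 * lam = 0 by ring, Real.exp_zero,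
      one_mul] at this
  have hstep : Real.exp (2 * lam) * (Q / 4) ≤ Real.exp (2 * lam) * ∫ z, opRem p₀ p₁ V' p h z
      * Real.exp (-2 * lam * z.1) ∂rectMeasure k₁ k₂ := by
    refine mul_le_mul_of_nonneg_left ?_ (Real.exp_pos _).le
    linarith
  linarith

/-! ### The forward problem -/

/-- A solution of `z' = i κ z` has constant modulus. -/
theorem norm_eq_of_hasDerivAt_rotation {z : ℝ → ℂ} {κ : ℝ} {s : Set ℝ} (hs : IsOpen s)
    (hc : IsPreconnected s) (hz : ∀ x ∈ s, HasDerivAt z (Complex.I * κ * z x) x) {x y : ℝ}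
    (hx : x ∈ s) (hy : y ∈ s) : ‖z x‖ = ‖z y‖ := by
  have hd : ∀ t ∈ s, HasDerivAt (fun t : ℝ => z t * Complex.exp ((-(κ * t) : ℝ) * Complex.I)) 0 t := by
    intro t ht
    have h1 : HasDerivAt (fun t : ℝ => ((-(κ * t) : ℝ) : ℂ) * Complex.I)
        (((-(κ * 1) : ℝ) : ℂ) * Complex.I) t :=
      (((hasDerivAt_id t).const_mul κ).neg.ofReal_comp).mul_const _
    refine ((hz t ht).mul h1.cexp).congr_deriv ?_
    push_cast
    ring
  have h := hs.is_const_of_deriv_eq_zero hc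
    (fun t ht => (hd t ht).differentiableAt.differentiableWithinAt) (fun t ht => (hd t ht).deriv) hx hy
  have h2 := congrArg norm h
  simpa only [norm_mul, Complex.norm_exp_ofReal_mul_I, mul_one] using h2

/-- The forward solution is bounded by `1 / k` at the left end of the medium, whatever the
coefficient. With `z_± = u' ± i k u`, the source makes `|z_-| = 1` on `(x₀, 0)`, while the
conserved flux `|z_+|² - |z_-|²` is nonpositive because `z_+ → 0` at `+∞`. -/
theorem IsForwardSolution.norm_zero_le {x₀ k : ℝ} {c : ℝ → ℝ} {u : ℝ → ℂ}
    (hu : IsForwardSolution x₀ k c u) (hc : IsCoefficient c) (hx : x₀ < 0) (hk : 0 < k) :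
    ‖u 0‖ ≤ 1 / k := by
  set v := deriv u with hv
  have hu' : ∀ x, x ≠ x₀ → HasDerivAt u (v x) x := fun x h => (hu.differentiableAt x h).hasDerivAt
  have hI : Complex.I * Complex.I = -1 := Complex.I_mul_I
  set zp : ℝ → ℂ := fun x => v x + Complex.I * k * u x with hzp
  set zm : ℝ → ℂ := fun x => v x - Complex.I * k * u x with hzm
  have hzm' : ∀ x, x ≠ x₀ → x < 0 → HasDerivAt zm (Complex.I * ((-k : ℝ) : ℂ) * zm x) x := by
    intro x h h0
    have h1 := (hu.equation x h).sub ((hu' x h).const_mul (Complex.I * k))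
    refine h1.congr_deriv ?_
    rw [hc.eq_one x (fun hm => by linarith [hm.1])]
    simp only [hzm]
    push_cast
    linear_combination (-(k : ℂ) ^ 2 * u x) * hI
  have hleft : ∀ x < x₀, zm x = 0 := by
    intro x hxx
    have h1 : ∀ᶠ y in atBot, ‖zm y‖ = ‖zm x‖ := by
      filter_upwards [Iio_mem_atBot x₀] with y hy
      exact norm_eq_of_hasDerivAt_rotation isOpen_Iio isPreconnected_Iio
        (fun t (ht : t < x₀) => hzm' t ht.ne (ht.trans hx)) hy hxx
    have h2 := hu.radiation_bot.norm
    rw [norm_zero] at h2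
    have h3 := tendsto_nhds_unique (h2.congr' h1) tendsto_const_nhds
    exact norm_eq_zero.1 h3.symm
  obtain ⟨a, b, ha, hb, hab⟩ := hu.jump
  have huL : Tendsto u (𝓝[<] x₀) (𝓝 (u x₀)) := hu.continuous.continuousWithinAt
  have huR : Tendsto u (𝓝[>] x₀) (𝓝 (u x₀)) := hu.continuous.continuousWithinAt
  have haeq : a - Complex.I * k * u x₀ = 0 := by
    have h1 : Tendsto zm (𝓝[<] x₀) (𝓝 (a - Complex.I * k * u x₀)) := ha.sub (huL.const_mul _)
    refine tendsto_nhds_unique (h1.congr' ?_) tendsto_const_nhds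
    filter_upwards [self_mem_nhdsWithin] with y hy using hleft y hy
  have hright : ∀ x ∈ Ioo x₀ 0, ‖zm x‖ = 1 := by
    intro x hxx
    have h1 : Tendsto zm (𝓝[>] x₀) (𝓝 (b - Complex.I * k * u x₀)) := hb.sub (huR.const_mul _)
    have h2 : b - Complex.I * k * u x₀ = -1 := by linear_combination hab + haeq
    rw [h2] at h1
    have h3 := h1.norm
    rw [norm_neg, norm_one] at h3
    refine tendsto_nhds_unique tendsto_const_nhds (h3.congr' ?_)
    filter_upwards [Ioo_mem_nhdsGT hx] with y hy
    exact norm_eq_of_hasDerivAt_rotation isOpen_Ioo isPreconnected_Ioo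
      (fun t ht => hzm' t ht.1.ne' ht.2) hy hxx
  have hflux : ∀ x, ‖zp x‖ ^ 2 - ‖zm x‖ ^ 2 = 4 * k * ((v x).im * (u x).re - (v x).re * (u x).im) := by
    intro x
    simp only [hzp, hzm, ← Complex.normSq_eq_norm_sq, Complex.normSq_apply, Complex.add_re,
      Complex.add_im, Complex.sub_re, Complex.sub_im, Complex.mul_re, Complex.mul_im, Complex.I_re,
      Complex.I_im, Complex.ofReal_re, Complex.ofReal_im]
    ring
  have hdflux : ∀ x ∈ Ioi x₀, HasDerivAt (fun x => (v x).im * (u x).re - (v x).re * (u x).im) 0 x := by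
    intro x hxx
    have hne : x ≠ x₀ := (mem_Ioi.1 hxx).ne'
    have hre : ∀ {f : ℝ → ℂ} {f' : ℂ}, HasDerivAt f f' x → HasDerivAt (fun x => (f x).re) f'.re x :=
      fun h => Complex.reCLM.hasFDerivAt.comp_hasDerivAt x h
    have him : ∀ {f : ℝ → ℂ} {f' : ℂ}, HasDerivAt f f' x → HasDerivAt (fun x => (f x).im) f'.im x :=
      fun h => Complex.imCLM.hasFDerivAt.comp_hasDerivAt x h
    have hE := hu.equation x hne
    have e : (-((k : ℂ) ^ 2 * (c x : ℂ) * u x)) = ((-(k ^ 2 * c x) : ℝ) : ℂ) * u x := by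
      push_cast; ring
    rw [e] at hE
    have h1 := ((him hE).mul (hre (hu' x hne))).sub ((hre hE).mul (him (hu' x hne)))
    refine h1.congr_deriv ?_
    rw [Complex.im_ofReal_mul, Complex.re_ofReal_mul]
    ring
  have hneg : ∀ x ∈ Ioi x₀, ‖zp x‖ ^ 2 - ‖zm x‖ ^ 2 ≤ 0 := by
    intro x hxx
    have h2 := (hu.radiation_top.norm).pow 2
    rw [norm_zero, zero_pow two_ne_zero] at h2
    refine ge_of_tendsto h2 ?_
    filter_upwards [Ioi_mem_atTop x₀] with y hy
    have h3 := isOpen_Ioi.is_const_of_deriv_eq_zero isPreconnected_Ioi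
      (fun t ht => (hdflux t ht).differentiableAt.differentiableWithinAt)
      (fun t ht => (hdflux t ht).deriv) hxx hy
    have h4 : ‖zp x‖ ^ 2 - ‖zm x‖ ^ 2 = ‖zp y‖ ^ 2 - ‖zm y‖ ^ 2 := by
      rw [hflux, hflux]
      exact congrArg _ h3
    rw [h4]
    exact sub_le_self _ (sq_nonneg _)
  have hle : ∀ x ∈ Ioo x₀ 0, ‖u x‖ ≤ 1 / k := by
    intro x hxx
    have h1 := hright x hxx
    have h2 := hneg x hxx.1
    have h3 : ‖zp x‖ ≤ 1 := by
      rw [h1] at h2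
      nlinarith [norm_nonneg (zp x)]
    have h4 : (2 * Complex.I * k) * u x = zp x - zm x := by simp only [hzp, hzm]; ring
    have h5 : 2 * k * ‖u x‖ ≤ 2 := by
      have h6 := norm_sub_le (zp x) (zm x)
      rw [← h4, norm_mul, norm_mul, norm_mul, Complex.norm_I, Complex.norm_ofNat,
        Complex.norm_real, Real.norm_eq_abs, abs_of_pos hk] at h6
      linarith
    rw [le_div_iff₀ hk]
    linarith
  have hlim : Tendsto (fun x => ‖u x‖) (𝓝[<] 0) (𝓝 ‖u 0‖) :=
    (hu.continuous.norm.tendsto 0).mono_left nhdsWithin_le_nhds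
  refine le_of_tendsto hlim ?_
  filter_upwards [Ioo_mem_nhdsLT hx] with x hxx using hle x hxx

theorem norm_ratio_zero_le {x₀ k : ℝ} {c : ℝ → ℝ} {us : ℝ → ℝ → ℂ}
    (hu : IsForwardSolution x₀ k c (fun x => us x k)) (hc : IsCoefficient c) (hx : x₀ < 0)
    (hk : 0 < k) : ‖ratio x₀ us 0 k‖ ≤ 2 := by
  have h1 := hu.norm_zero_le hc hx hk
  have h2 : ‖incident x₀ 0 k‖ = 1 / (2 * k) := by
    have e : -(Complex.I * k * (|0 - x₀| : ℝ)) = ((-(k * |0 - x₀|) : ℝ) : ℂ) * Complex.I := by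
      push_cast; ring
    rw [incident, e, norm_div, Complex.norm_exp_ofReal_mul_I, norm_mul, norm_mul, Complex.norm_I,
      Complex.norm_ofNat, Complex.norm_real, Real.norm_eq_abs, abs_of_pos hk, mul_one]
  rw [ratio, norm_div, h2, div_le_iff₀ (by positivity)]
  refine h1.trans (le_of_eq ?_)
  field_simp

/-! ### Bounds for the noisy data -/

theorem hasDerivWithinAt_log {k₁ k₂ k : ℝ} {g ℓ : ℝ → ℂ} {g' : ℂ}
    (hℓ : ContinuousOn ℓ (Icc k₁ k₂)) (hexp : ∀ k ∈ Icc k₁ k₂, Complex.exp (ℓ k) = g k)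
    (hk : k ∈ Icc k₁ k₂) (hg : HasDerivWithinAt g g' (Icc k₁ k₂) k) :
    HasDerivWithinAt ℓ (g' / g k) (Icc k₁ k₂) k := by
  have hgk : g k ≠ 0 := by rw [← hexp k hk]; exact Complex.exp_ne_zero _
  -- Near `k` the function is `ℓ k` plus the principal logarithm of `g / g k`.
  have h1 : HasDerivWithinAt (fun s => ℓ k + Complex.log (g s / g k)) (g' / g k) (Icc k₁ k₂) k := by
    have h2 := (hg.div_const (g k)).clog_real (by rw [div_self hgk]; exact Complex.one_mem_slitPlane)
    refine (h2.const_add (ℓ k)).congr_deriv ?_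
    rw [div_self hgk, div_one]
  refine h1.congr_of_eventuallyEq ?_ (by simp [hgk])
  have h3 : Tendsto (fun s => (ℓ s - ℓ k).im) (𝓝[Icc k₁ k₂] k) (𝓝 0) := by
    have h4 := Complex.continuous_im.continuousAt.tendsto.comp ((hℓ k hk).sub_const (ℓ k))
    simpa [Function.comp_def] using h4
  have h5 := h3.eventually (Ioo_mem_nhds (neg_lt_zero.2 Real.pi_pos) Real.pi_pos)
  filter_upwards [h5, self_mem_nhdsWithin] with s hs hm
  rw [← hexp s hm, ← hexp k hk, ← Complex.exp_sub, Complex.log_exp hs.1 hs.2.le]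
  ring

/-- The derivative of the trace `(2 i / k) (1 - 1 / g)`. -/
theorem hasDerivWithinAt_trace {k₁ k₂ k : ℝ} {g : ℝ → ℂ} {g' : ℂ} (hk : k ≠ 0) (hgk : g k ≠ 0)
    (hg : HasDerivWithinAt g g' (Icc k₁ k₂) k) :
    HasDerivWithinAt (fun s : ℝ => 2 * Complex.I / s * (1 - 1 / g s))
      (-(2 * Complex.I / (k : ℂ) ^ 2) * (1 - 1 / g k)
        + 2 * Complex.I / k * (g' / g k ^ 2)) (Icc k₁ k₂) k := by
  have hkc : (k : ℂ) ≠ 0 := Complex.ofReal_ne_zero.2 hk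
  have h1 : HasDerivWithinAt (fun s : ℝ => (s : ℂ)) 1 (Icc k₁ k₂) k :=
    Complex.ofRealCLM.hasDerivAt.hasDerivWithinAt
  have h2 := ((hasDerivWithinAt_const k (Icc k₁ k₂) (2 * Complex.I)).div h1 hkc).mul
    ((hasDerivWithinAt_const k (Icc k₁ k₂) (1 : ℂ)).sub
      ((hasDerivWithinAt_const k (Icc k₁ k₂) (1 : ℂ)).div hg hgk))
  refine h2.congr_deriv ?_
  simp only [Pi.div_apply, Pi.sub_apply]
  field_simp
  ring

theorem hasDerivWithinAt_div_sq {k₁ k₂ k : ℝ} {ℓ : ℝ → ℂ} {ℓ' : ℂ} (hk : k ≠ 0)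
    (hℓ : HasDerivWithinAt ℓ ℓ' (Icc k₁ k₂) k) :
    HasDerivWithinAt (fun s : ℝ => ℓ s / (s : ℂ) ^ 2)
      (ℓ' / (k : ℂ) ^ 2 - 2 * ℓ k / (k : ℂ) ^ 3) (Icc k₁ k₂) k := by
  have hkc : (k : ℂ) ≠ 0 := Complex.ofReal_ne_zero.2 hk
  have h1 : HasDerivWithinAt (fun s : ℝ => (s : ℂ)) 1 (Icc k₁ k₂) k :=
    Complex.ofRealCLM.hasDerivAt.hasDerivWithinAt
  have h2 := hℓ.div (h1.pow 2) (pow_ne_zero 2 hkc)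
  refine h2.congr_deriv ?_
  simp only [Pi.pow_apply]
  field_simp
  ring

/-- Bounds for the boundary data in terms of `k₁`, `k₂`, a bound `A` for the exact logarithm at
`k₂`, and the bound `M` for `p₁`. Integrating `p₁` from `k₂` bounds the trace `(2 i / k)(1 - 1/g)`;
together with `‖g‖ ≤ 3` this bounds the logarithmic derivative `g' / g`, hence `log g` and `p₀`. -/
theorem exists_data_bounds (k₁ k₂ A M : ℝ) (hk0 : 0 < k₁) (hk : k₁ < k₂) (hA : 0 ≤ A) :
    ∃ P α β : ℝ, ∀ (gs ℓs g ℓ : ℝ → ℂ) (δ : ℝ), δ < 1 → IsNoisyData k₁ k₂ δ gs ℓs g ℓ →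
      (∀ k ∈ Icc k₁ k₂, ‖gs k‖ ≤ 2) → ‖ℓs k₂‖ ≤ A →
      (∀ k ∈ Icc k₁ k₂, ‖bdry₁ k₁ k₂ g k‖ ≤ M) →
      ContinuousOn (bdry₀ k₁ k₂ ℓ) (Icc k₁ k₂) ∧ ContinuousOn (bdry₁ k₁ k₂ g) (Icc k₁ k₂) ∧
      (∀ k ∈ Icc k₁ k₂, ‖bdry₀ k₁ k₂ ℓ k‖ ≤ P) ∧ (∀ k ∈ Icc k₁ k₂, ‖bdry₁ k₁ k₂ g k‖ ≤ P) ∧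
      ‖ℓ k₂ / (k₂ : ℂ) ^ 2‖ ≤ α ∧ ‖2 * Complex.I / k₂ * (1 - 1 / g k₂)‖ ≤ β := by
  have hk20 : 0 < k₂ := hk0.trans hk
  set β := 2 / k₂ * (1 + Real.exp (A + 1)) with hβ
  set Λ := 3 * k₂ / 2 * (M + (β + M * (k₂ - k₁)) / k₁) with hΛ
  set W := A + 1 + Λ * (k₂ - k₁) with hW
  refine ⟨max (Λ / k₁ ^ 2 + 2 * W / k₁ ^ 3) M, (A + 1) / k₂ ^ 2, β, ?_⟩
  intro gs ℓs g ℓ δ hδ hN hgs hℓs hM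
  have hmem : k₂ ∈ Icc k₁ k₂ := right_mem_Icc.2 hk.le
  have hpos : ∀ k ∈ Icc k₁ k₂, 0 < k := fun k h => hk0.trans_le h.1
  have hM0 : 0 ≤ M := (norm_nonneg _).trans (hM k₂ hmem)
  have hudiff := uniqueDiffOn_Icc hk
  have hg0 : ∀ k ∈ Icc k₁ k₂, g k ≠ 0 := fun k h => by
    rw [← hN.exp_log k h]; exact Complex.exp_ne_zero _
  set g' := derivWithin g (Icc k₁ k₂) with hg'
  have hgd : ∀ k ∈ Icc k₁ k₂, HasDerivWithinAt g (g' k) (Icc k₁ k₂) k := fun k h =>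
    (hN.contDiffOn.differentiableOn (by simp) k h).hasDerivWithinAt
  have hg'c : ContinuousOn g' (Icc k₁ k₂) := hN.contDiffOn.continuousOn_derivWithin hudiff le_rfl
  have hℓd : ∀ k ∈ Icc k₁ k₂, HasDerivWithinAt ℓ (g' k / g k) (Icc k₁ k₂) k := fun k h =>
    hasDerivWithinAt_log hN.continuousOn_log hN.exp_log h (hgd k h)
  have e₁ : ∀ k ∈ Icc k₁ k₂, bdry₁ k₁ k₂ g k = -(2 * Complex.I / (k : ℂ) ^ 2) * (1 - 1 / g k)
      + 2 * Complex.I / k * (g' k / g k ^ 2) := fun k h =>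
    (hasDerivWithinAt_trace (hpos k h).ne' (hg0 k h) (hgd k h)).derivWithin (hudiff k h)
  have e₀ : ∀ k ∈ Icc k₁ k₂, bdry₀ k₁ k₂ ℓ k
      = g' k / g k / (k : ℂ) ^ 2 - 2 * ℓ k / (k : ℂ) ^ 3 := fun k h =>
    (hasDerivWithinAt_div_sq (hpos k h).ne' (hℓd k h)).derivWithin (hudiff k h)
  have hid : ContinuousOn (fun k : ℝ => (k : ℂ)) (Icc k₁ k₂) := Complex.continuous_ofReal.continuousOn
  have hidne : ∀ k ∈ Icc k₁ k₂, (k : ℂ) ≠ 0 := fun k h => Complex.ofReal_ne_zero.2 (hpos k h).ne'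
  have hgc := hN.contDiffOn.continuousOn
  have hℓ2 : ‖ℓ k₂‖ ≤ A + 1 := by
    have := norm_sub_norm_le (ℓ k₂) (ℓs k₂)
    linarith [hN.log_close k₂ hmem]
  set F : ℝ → ℂ := fun s => 2 * Complex.I / s * (1 - 1 / g s) with hF
  have hF2 : ‖F k₂‖ ≤ β := by
    have h1 : ‖1 / g k₂‖ ≤ Real.exp (A + 1) := by
      rw [← hN.exp_log k₂ hmem, one_div, ← Complex.exp_neg, Complex.norm_exp]
      exact Real.exp_le_exp.2 ((Complex.re_le_norm _).trans (by rwa [norm_neg]))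
    simp only [hF, norm_mul, norm_div, Complex.norm_I, Complex.norm_ofNat, Complex.norm_real,
      Real.norm_eq_abs, abs_of_pos hk20, mul_one]
    rw [hβ]
    refine mul_le_mul_of_nonneg_left ?_ (by positivity)
    refine (norm_sub_le _ _).trans ?_
    rw [norm_one]
    linarith
  have hFd : ∀ k ∈ Icc k₁ k₂, HasDerivWithinAt F (bdry₁ k₁ k₂ g k) (Icc k₁ k₂) k := fun k h => by
    rw [e₁ k h]
    exact hasDerivWithinAt_trace (hpos k h).ne' (hg0 k h) (hgd k h)
  have hlen : ∀ k ∈ Icc k₁ k₂, ‖k - k₂‖ ≤ k₂ - k₁ := fun k h => by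
    rw [Real.norm_eq_abs, abs_le]
    constructor <;> linarith [h.1, h.2]
  have hFb : ∀ k ∈ Icc k₁ k₂, ‖F k‖ ≤ β + M * (k₂ - k₁) := by
    intro k h
    have h1 := (convex_Icc k₁ k₂).norm_image_sub_le_of_norm_hasDerivWithin_le hFd hM hmem h
    have h2 := norm_sub_norm_le (F k) (F k₂)
    have h3 := mul_le_mul_of_nonneg_left (hlen k h) hM0
    linarith
  have hβ0 : 0 ≤ β := by positivity
  have hkk : 0 ≤ k₂ - k₁ := by linarith
  have hΛ0 : 0 ≤ Λ := by positivity
  have hquot : ∀ k ∈ Icc k₁ k₂, ‖g' k / g k‖ ≤ Λ := by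
    intro k h
    have hk' := hpos k h
    have h1 : g' k / g k = g k * (k / (2 * Complex.I)) * (bdry₁ k₁ k₂ g k + F k / k) := by
      have := hidne k h
      have := hg0 k h
      have := Complex.I_ne_zero
      rw [e₁ k h]
      simp only [hF]
      field_simp
      ring
    have h2 : ‖g k‖ ≤ 3 := by
      have := norm_sub_norm_le (g k) (gs k)
      linarith [hN.close k h, hgs k h]
    rw [h1, norm_mul, norm_mul, norm_div, norm_mul, Complex.norm_I, Complex.norm_ofNat,
      Complex.norm_real, Real.norm_eq_abs, abs_of_pos hk', mul_one, hΛ]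
    have h3 : ‖bdry₁ k₁ k₂ g k + F k / k‖ ≤ M + (β + M * (k₂ - k₁)) / k₁ := by
      refine (norm_add_le _ _).trans (add_le_add (hM k h) ?_)
      rw [norm_div, Complex.norm_real, Real.norm_eq_abs, abs_of_pos hk']
      exact div_le_div₀ (by positivity) (hFb k h) hk0 h.1
    have h4 : ‖g k‖ * (k / 2) ≤ 3 * k₂ / 2 := by
      have := mul_le_mul h2 h.2 hk'.le (by norm_num)
      linarith
    exact mul_le_mul h4 h3 (norm_nonneg _) (by positivity)
  have hℓb : ∀ k ∈ Icc k₁ k₂, ‖ℓ k‖ ≤ W := by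
    intro k h
    have h1 := (convex_Icc k₁ k₂).norm_image_sub_le_of_norm_hasDerivWithin_le hℓd hquot hmem h
    have h2 := norm_sub_norm_le (ℓ k) (ℓ k₂)
    have h3 := mul_le_mul_of_nonneg_left (hlen k h) hΛ0
    linarith
  have hW0 : 0 ≤ W := by positivity
  refine ⟨?_, ?_, fun k h => ?_, fun k h => (hM k h).trans (le_max_right _ _), ?_, hF2⟩
  · refine ContinuousOn.congr ?_ e₀
    exact ((hg'c.div hgc hg0).div (hid.pow 2) fun k h => pow_ne_zero 2 (hidne k h)).sub
      ((continuousOn_const.mul hN.continuousOn_log).div (hid.pow 3)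
        fun k h => pow_ne_zero 3 (hidne k h))
  · refine ContinuousOn.congr ?_ e₁
    exact ((continuousOn_const.div (hid.pow 2) fun k h => pow_ne_zero 2 (hidne k h)).neg.mul
      (continuousOn_const.sub (continuousOn_const.div hgc hg0))).add
      ((continuousOn_const.div hid hidne).mul
        (hg'c.div (hgc.pow 2) fun k h => pow_ne_zero 2 (hg0 k h)))
  · refine le_trans ?_ (le_max_left _ _)
    rw [e₀ k h]
    refine (norm_sub_le _ _).trans ?_
    rw [norm_div, norm_div (2 * ℓ k), norm_pow, norm_pow, norm_mul, Complex.norm_real,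
      Real.norm_eq_abs, abs_of_pos (hpos k h), Complex.norm_ofNat]
    refine add_le_add ?_ ?_
    · exact div_le_div₀ hΛ0 (hquot k h) (by positivity) (pow_le_pow_left₀ hk0.le h.1 2)
    · exact div_le_div₀ (by positivity) (mul_le_mul_of_nonneg_left (hℓb k h) zero_le_two)
        (by positivity) (pow_le_pow_left₀ hk0.le h.1 3)
  · rw [norm_div, norm_pow, Complex.norm_real, Real.norm_eq_abs, abs_of_pos hk20]
    gcongr

/-! ### Bounds for the tail -/

theorem isWeakDeriv_of_hasDerivAt {F F' : ℝ → ℂ} (h : ∀ x, HasDerivAt F (F' x) x)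
    (hF' : Continuous F') : IsWeakDeriv F F' := by
  intro φ h1 h2 h3
  have hz : ∀ x, x ∉ Ioo (0 : ℝ) 1 → φ x = 0 := fun x hx =>
    image_eq_zero_of_notMem_tsupport fun hm => hx (h3 hm)
  have hd : Continuous (deriv φ) := h1.continuous_deriv (by simp)
  have hφ : ∀ x, HasDerivAt (fun x => ((φ x : ℝ) : ℂ)) ((deriv φ x : ℝ) : ℂ) x := fun x =>
    ((h1.differentiable (by simp)) x).hasDerivAt.ofReal_comp
  have hibp := intervalIntegral.integral_mul_deriv_eq_deriv_mul (a := 0) (b := 1)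
    (fun x _ => h x) (fun x _ => hφ x) (hF'.intervalIntegrable _ _)
    ((Complex.continuous_ofReal.comp hd).intervalIntegrable _ _)
  rw [hz 0 (by simp), hz 1 (by simp)] at hibp
  simp only [Complex.ofReal_zero, mul_zero, sub_zero, zero_sub] at hibp
  rw [intervalIntegral.integral_of_le zero_le_one, intervalIntegral.integral_of_le zero_le_one,
    integral_Ioc_eq_integral_Ioo, integral_Ioc_eq_integral_Ioo] at hibp
  simpa only [mul_comm] using hibp

/-- The quadratic polynomial `a + b x - (b / 2) x²` and its derivatives: a competitor in the
minimization problem for the tail. -/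
def tailCompetitor (a b : ℂ) : Fin 4 → ℝ → ℂ :=
  ![fun x => a + b * x - b / 2 * (x : ℂ) ^ 2, fun x => b - b * x, fun _ => -b, fun _ => 0]

theorem memW_tailCompetitor (k₂ : ℝ) (g ℓ : ℝ → ℂ) : MemW k₂ g ℓ
    (tailCompetitor (ℓ k₂ / (k₂ : ℂ) ^ 2) (2 * Complex.I / k₂ * (1 - 1 / g k₂))) := by
  set a := ℓ k₂ / (k₂ : ℂ) ^ 2
  set b := 2 * Complex.I / k₂ * (1 - 1 / g k₂)
  have hid : ∀ x : ℝ, HasDerivAt (fun x : ℝ => (x : ℂ)) 1 x := fun x =>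
    Complex.ofRealCLM.hasDerivAt
  have d0 : ∀ x : ℝ, HasDerivAt (fun x : ℝ => a + b * x - b / 2 * (x : ℂ) ^ 2) (b - b * x) x := by
    intro x
    refine ((((hid x).const_mul b).const_add a).sub (((hid x).pow 2).const_mul (b / 2))).congr_deriv ?_
    push_cast
    ring
  have d1 : ∀ x : ℝ, HasDerivAt (fun x : ℝ => b - b * x) (-b) x := by
    intro x
    refine (((hid x).const_mul b).const_sub b).congr_deriv ?_
    ring
  have d2 : ∀ x : ℝ, HasDerivAt (fun _ : ℝ => -b) 0 x := fun x => hasDerivAt_const x _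
  have hmem : ∀ f : ℝ → ℂ, Continuous f → MemLp f 2 unitMeasure := by
    intro f hf
    obtain ⟨C, hC⟩ := isCompact_Icc.exists_bound_of_continuousOn (s := Icc (0 : ℝ) 1) hf.continuousOn
    refine MemLp.of_bound hf.aestronglyMeasurable C ?_
    filter_upwards [ae_restrict_mem measurableSet_Ioo] with x hx
    exact hC x (Ioo_subset_Icc_self hx)
  have c0 : ContDiff ℝ 1 (fun x : ℝ => a + b * x - b / 2 * (x : ℂ) ^ 2) := by
    have : ContDiff ℝ 1 (fun x : ℝ => (x : ℂ)) := Complex.ofRealCLM.contDiff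
    fun_prop
  have c1 : Continuous (fun x : ℝ => b - b * (x : ℂ)) := by fun_prop
  refine ⟨⟨?_, ?_⟩, _, c0.contDiffOn, ae_eq_refl _, ?_, ?_, ?_⟩
  · intro j
    fin_cases j
    exacts [hmem _ c0.continuous, hmem _ c1, hmem _ continuous_const, hmem _ continuous_const]
  · intro j
    fin_cases j
    exacts [isWeakDeriv_of_hasDerivAt d0 c1, isWeakDeriv_of_hasDerivAt d1 continuous_const,
      isWeakDeriv_of_hasDerivAt d2 continuous_const]
  · simp [a]
  · rw [(d0 0).hasDerivWithinAt.derivWithin (uniqueDiffOn_Icc zero_lt_one 0 (by simp))]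
    simp [b]
  · rw [(d0 1).hasDerivWithinAt.derivWithin (uniqueDiffOn_Icc zero_lt_one 1 (by simp))]
    simp

theorem integral_sq_le_of_norm_le {f : ℝ → ℂ} {C : ℝ} (h : ∀ x ∈ Ioo (0 : ℝ) 1, ‖f x‖ ≤ C) :
    ∫ x, ‖f x‖ ^ 2 ∂unitMeasure ≤ C ^ 2 := by
  have h1 : ∀ᵐ x ∂unitMeasure, ‖(‖f x‖ ^ 2)‖ ≤ C ^ 2 := by
    filter_upwards [ae_restrict_mem measurableSet_Ioo] with x hx
    rw [norm_pow, norm_norm]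
    exact pow_le_pow_left₀ (norm_nonneg _) (h x hx) 2
  have h2 := norm_integral_le_of_norm_le_const h1
  refine (le_abs_self _).trans (h2.trans (le_of_eq ?_))
  simp

/-- The derivative of the tail is bounded in terms of the boundary values: comparison with a
polynomial bounds `‖V''‖` in `L^2`, uniformly for regularization parameters in `[0, 1]`. -/
theorem IsTail.norm_deriv_le {k₂ ε α β : ℝ} {g ℓ : ℝ → ℂ} {V : Fin 4 → ℝ → ℂ}
    (hV : IsTail k₂ ε g ℓ V) (hε0 : 0 ≤ ε) (hε1 : ε ≤ 1) (ha : ‖ℓ k₂ / (k₂ : ℂ) ^ 2‖ ≤ α)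
    (hb : ‖2 * Complex.I / k₂ * (1 - 1 / g k₂)‖ ≤ β) :
    ∀ᵐ x ∂unitMeasure, ‖V 1 x‖ ≤ β + √(β ^ 2 + ((α + 2 * β) ^ 2 + (2 * β) ^ 2 + β ^ 2)) := by
  have hmin := hV.2 _ (memW_tailCompetitor k₂ g ℓ)
  obtain ⟨hS, hB⟩ := hV.1
  set a := ℓ k₂ / (k₂ : ℂ) ^ 2
  set b := 2 * Complex.I / k₂ * (1 - 1 / g k₂)
  have hβ : 0 ≤ β := (norm_nonneg _).trans hb
  have E0 : ∫ x, ‖tailCompetitor a b 0 x‖ ^ 2 ∂unitMeasure ≤ (α + 2 * β) ^ 2 := by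
    refine integral_sq_le_of_norm_le fun x hx => ?_
    change ‖a + b * x - b / 2 * (x : ℂ) ^ 2‖ ≤ _
    have h1 : ‖b * (x : ℂ)‖ ≤ β := by
      rw [norm_mul, Complex.norm_real, Real.norm_eq_abs, abs_of_pos hx.1]
      nlinarith [hx.1, hx.2, norm_nonneg b]
    have h2 : ‖b / 2 * (x : ℂ) ^ 2‖ ≤ β := by
      rw [norm_mul, norm_div, norm_pow, Complex.norm_real, Real.norm_eq_abs, abs_of_pos hx.1,
        Complex.norm_ofNat]
      have : x ^ 2 ≤ 1 := pow_le_one₀ hx.1.le hx.2.le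
      nlinarith [norm_nonneg b, sq_nonneg x]
    linarith [norm_sub_le (a + b * x) (b / 2 * (x : ℂ) ^ 2), norm_add_le a (b * x)]
  have E1 : ∫ x, ‖tailCompetitor a b 1 x‖ ^ 2 ∂unitMeasure ≤ (2 * β) ^ 2 := by
    refine integral_sq_le_of_norm_le fun x hx => ?_
    change ‖b - b * x‖ ≤ _
    have h1 : ‖b * (x : ℂ)‖ ≤ β := by
      rw [norm_mul, Complex.norm_real, Real.norm_eq_abs, abs_of_pos hx.1]
      nlinarith [hx.1, hx.2, norm_nonneg b]
    linarith [norm_sub_le b (b * x)]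
  have E2 : ∫ x, ‖tailCompetitor a b 2 x‖ ^ 2 ∂unitMeasure ≤ β ^ 2 := by
    refine integral_sq_le_of_norm_le fun x _ => ?_
    change ‖-b‖ ≤ _
    rwa [norm_neg]
  have E3 : ∫ x, ‖tailCompetitor a b 3 x‖ ^ 2 ∂unitMeasure = 0 := by
    have h : ∀ x, tailCompetitor a b 3 x = 0 := fun _ => rfl
    simp [h]
  have hnn : ∀ (D : Fin 4 → ℝ → ℂ), 0 ≤ sobolevNormSq 3 D := fun D =>
    Finset.sum_nonneg fun j _ => integral_nonneg fun x => sq_nonneg _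
  have hES : sobolevNormSq 3 (tailCompetitor a b) ≤ (α + 2 * β) ^ 2 + (2 * β) ^ 2 + β ^ 2 := by
    rw [sobolevNormSq, Fin.sum_univ_four]
    linarith
  have hV2 : ∫ x, ‖V 2 x‖ ^ 2 ∂unitMeasure
      ≤ β ^ 2 + ((α + 2 * β) ^ 2 + (2 * β) ^ 2 + β ^ 2) := by
    rw [tailFunctional, tailFunctional] at hmin
    have h1 := mul_nonneg hε0 (hnn V)
    have h2 := mul_le_of_le_one_left (hnn (tailCompetitor a b)) hε1
    linarith
  have hprim := (hB.ae_eq_primitive (hS.memLp 0) (hS.memLp 1) (hS.memLp 2)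
    (hS.weakDeriv 0) (hS.weakDeriv 1)).2
  filter_upwards [hprim, ae_restrict_mem measurableSet_Ioo] with x hx hm
  rw [hx]
  refine (norm_add_le _ _).trans (add_le_add hb (Real.le_sqrt_of_sq_le ?_))
  have h := norm_primitive_sq_mul_exp_le (hS.memLp 2) (lam := 0) (c := 1)
    (fun x hx => by simpa using hx.2.le) hm
  simp only [mul_zero, zero_mul, Real.exp_zero, mul_one, one_mul] at h
  exact h.trans hV2

end

end InverseMedium

theorem theorem4p1 :
    ∃ C : ℝ, 0 < C ∧
      ∀ (x₀ k₁ k₂ : ℝ), x₀ < 0 → 0 < k₁ → k₁ < k₂ →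
      ∀ (rs : ℝ → ℂ) (M R : ℝ), 0 < R →
      ∃ lam₀ : ℝ, 1 < lam₀ ∧
        ∀ (cs : ℝ → ℝ) (us ψs : ℝ → ℝ → ℂ) (δ : ℝ) (g ℓ : ℝ → ℂ) (V : Fin 4 → ℝ → ℂ),
          -- the exact solution, its noiseless data and its tail `rs / k₂`
          InverseMedium.IsCoefficient cs →
          (∀ k, 0 < k → InverseMedium.IsForwardSolution x₀ k cs (fun x => us x k)) →
          InverseMedium.IsLogBranch x₀ cs (InverseMedium.ratio x₀ us) ψs →
          (∀ x ∈ Set.Icc (0 : ℝ) 1, ψs x k₂ / (k₂ : ℂ) ^ 2 = rs x / k₂) →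
          -- the noisy data and the tail computed from them
          0 < δ → δ < 1 →
          InverseMedium.IsNoisyData k₁ k₂ δ (InverseMedium.ratio x₀ us 0) (ψs 0) g ℓ →
          (∀ k ∈ Set.Icc k₁ k₂, ‖InverseMedium.bdry₁ k₁ k₂ g k‖ ≤ M) →
          InverseMedium.IsTail k₂ (δ ^ 2) g ℓ V →
          -- the functional is finite and Fréchet differentiable on the whole space
          (∀ p : InverseMedium.spaceH k₁ k₂,
            MeasureTheory.MemLp (InverseMedium.opL (InverseMedium.bdry₀ k₁ k₂ ℓ)
              (InverseMedium.bdry₁ k₁ k₂ g) (V 1) p) 2 (InverseMedium.rectMeasure k₁ k₂)) ∧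
          (∀ (lam : ℝ) (p : InverseMedium.spaceH k₁ k₂),
            DifferentiableAt ℝ (InverseMedium.costJ (InverseMedium.bdry₀ k₁ k₂ ℓ)
              (InverseMedium.bdry₁ k₁ k₂ g) (V 1) lam) p) ∧
          -- strict convexity on the closed ball
          ∀ lam : ℝ, lam₀ ≤ lam → ∀ p h : InverseMedium.spaceH k₁ k₂,
            p ∈ Metric.closedBall 0 R → p + h ∈ Metric.closedBall 0 R →
            C * ‖h‖ ^ 2 ≤
              InverseMedium.costJ (InverseMedium.bdry₀ k₁ k₂ ℓ)
                  (InverseMedium.bdry₁ k₁ k₂ g) (V 1) lam (p + h)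
                - InverseMedium.costJ (InverseMedium.bdry₀ k₁ k₂ ℓ)
                  (InverseMedium.bdry₁ k₁ k₂ g) (V 1) lam p
                - fderiv ℝ (InverseMedium.costJ (InverseMedium.bdry₀ k₁ k₂ ℓ)
                  (InverseMedium.bdry₁ k₁ k₂ g) (V 1) lam) p h := by
  refine ⟨1 / 12, by norm_num, ?_⟩
  intro x₀ k₁ k₂ hx₀ hk₁ hk rs M R _
  have hk₂ : 0 < k₂ := hk₁.trans hk
  obtain ⟨P, α, β, hdata⟩ := InverseMedium.exists_data_bounds k₁ k₂ (k₂ * ‖rs 0‖) M hk₁ hk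
    (by positivity)
  obtain ⟨lam₀, hlam₀, hconv⟩ := InverseMedium.exists_strictConvexity k₁ k₂ P
    (β + √(β ^ 2 + ((α + 2 * β) ^ 2 + (2 * β) ^ 2 + β ^ 2))) R hk₁ hk.le
  refine ⟨lam₀, hlam₀, ?_⟩
  intro cs us ψs δ g ℓ V hcs hus _ hrs hδ0 hδ1 hN hM hV
  -- The exact tail fixes the exact logarithm at the highest frequency.
  have hψ : ‖ψs 0 k₂‖ ≤ k₂ * ‖rs 0‖ := by
    have hkc : (k₂ : ℂ) ≠ 0 := Complex.ofReal_ne_zero.2 hk₂.ne'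
    have h : ψs 0 k₂ = k₂ * rs 0 := by
      have := hrs 0 (by simp)
      field_simp at this
      linear_combination this
    rw [h, norm_mul, Complex.norm_real, Real.norm_eq_abs, abs_of_pos hk₂]
  obtain ⟨hc₀, hc₁, hb₀, hb₁, hα, hβ⟩ := hdata _ _ g ℓ δ hδ1 hN
    (fun k h => InverseMedium.norm_ratio_zero_le (hus k (hk₁.trans_le h.1)) hcs hx₀
      (hk₁.trans_le h.1)) hψ hM
  have hsub : Set.Ioo k₁ k₂ ⊆ Set.Icc k₁ k₂ := Set.Ioo_subset_Icc_self
  have hd : InverseMedium.IsBoundedData k₁ k₂ P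
      (β + √(β ^ 2 + ((α + 2 * β) ^ 2 + (2 * β) ^ 2 + β ^ 2)))
      (InverseMedium.bdry₀ k₁ k₂ ℓ) (InverseMedium.bdry₁ k₁ k₂ g) (V 1) :=
    { meas₀ := (hc₀.mono hsub).aestronglyMeasurable measurableSet_Ioo
      meas₁ := (hc₁.mono hsub).aestronglyMeasurable measurableSet_Ioo
      measV := (hV.1.1.memLp 1).1
      bound₀ := fun k h => hb₀ k (hsub h)
      bound₁ := fun k h => hb₁ k (hsub h)
      boundV := hV.norm_deriv_le (sq_nonneg δ) (pow_le_one₀ hδ0.le hδ1.le) hα hβ }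
  refine ⟨fun p => (hd.memLp_opL hk₁ hk.le p le_rfl).1, fun lam p => ?_, hconv _ _ _ hd⟩
  obtain ⟨D, hD, -⟩ := hd.hasFDerivAt_costJ hk₁ hk.le lam p
  exact hD.differentiableAt
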